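/- Let $(G_n)_{n\ge 1}$ be probability distributions on $\mathbb R$ and let $\Phi=N(0,1)$. For $\beta\ge 0$ put $\pi_n=n^{-\beta}$. Under $H_0^n$ the coordinates of $X\in\mathbb R^n$ are i.i.d. $\Phi$. Under $H_1^n=H_1^n(\beta)$ they are $X_i=\mu_i+Z_i$ with $\mu_1,\dots,\mu_n$ i.i.d. from $(1-\pi_n)\delta_0+\pi_nG_n$ and, independently, $Z_1,\dots,Z_n$ i.i.d. from $\Phi$. Let $d_{TV}(P,Q)=\sup_A|P(A)-Q(A)|$ and put $$\underline\beta^*=\sup\{\beta\ge 0:\ d_{TV}(H_0^n,H_1^n(\beta))\to 1\},\qquad \bar\beta^*=\inf\{\beta\in[0,1]:\ d_{TV}(H_0^n,H_1^n(\beta))\to 0\}\qquad(n\to\infty),$$ with $\sup\emptyset=0$ and $\inf\emptyset=1$. If $\underline\beta^*=\bar\beta^*$, the common value $\beta^*$ is called the critical sparsity level. Let $$\tau_n(\delta)=\log_n \mathbb P\big(|\mu+Z|>\sqrt{2\delta\log n}\big),\qquad \mu\sim G_n,\ Z\sim\Phi\ \text{independent},$$ and assume that $\tau_n$ converges uniformly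 on $[0,1]$ as $n\to\infty$ to some real-valued function. For $\alpha\in(0,1)$, the level-$\alpha$ max test rejects when $\max_i|X_i|>m(n,\alpha)$, where $m(n,\alpha)$ is the $(1-\alpha)$-quantile of $\max_i|X_i|$ under $H_0^n$. **Theorem 1.** Suppose that $\bar\beta^*>1/2$ (as is the case when $\beta^*$ exists and exceeds $1/2$), and that either (A1) $\bar\beta^*>3/4$, or (A2) there are a distribution function $G$ on $\mathbb R$ and numbers $\sigma_n>0$ such that $G_n(\mu)=G(\mu/\sigma_n)$ for all $n$ and $\mu$ (here $G_n$ denotes the distribution function), and $Q(\theta)=-\max\{\log(1-G(\theta)),\log G(-\theta)\}$ (with $\log 0=-\infty$) is finite and positive for all large $\theta$ and is regularly varying with some index $\gamma\le 2$, i.e. $Q(t\theta)/Q(\theta)\to t^{\gamma}$ as $\theta\to\infty$ for every $t>0$. Then the critical sparsity level exists, i.e. $\underline\beta^*=\bar\beta^*=\beta^*$, and for every $\beta\in(0,\beta^*)$ and every $\alpha\in(0,1)$ the level-$\alpha$ max test has full asymptotic power: $\mathbb P_{H_1^n(\beta)}\big(\max_i|X_i|>m(n,\alpha)\big)\to 1$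 as $n\to\infty$. -/

import Mathlib

open MeasureTheory ProbabilityTheory Filter Topology

noncomputable section

namespace SparseMeans

/-- Law of a single mean under the alternative: `(1 - n^{-β}) δ₀ + n^{-β} G`. -/
def prior (G : Measure ℝ) (n : ℕ) (β : ℝ) : Measure ℝ :=
  ENNReal.ofReal (1 - (n : ℝ) ^ (-β)) • Measure.dirac 0 + ENNReal.ofReal ((n : ℝ) ^ (-β)) • G

/-- Law of `μ + Z` with `μ ∼ ν` and an independent standard normal `Z`. -/
def gaussianMixture (ν : Measure ℝ) : Measure ℝ :=
  Measure.conv ν (gaussianReal 0 1)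

/-- Law of the observation vector `X ∈ ℝⁿ` under the global null: `n` i.i.d. standard normals. -/
def nullLaw (n : ℕ) : Measure (Fin n → ℝ) :=
  Measure.pi fun _ => gaussianReal 0 1

/-- Law of `X ∈ ℝⁿ` under the alternative: `Xᵢ = μᵢ + Zᵢ`, with i.i.d. means `μᵢ` drawn from the
sparse mixture and independent i.i.d. standard normal `Zᵢ`. -/
def altLaw (G : ℕ → Measure ℝ) (β : ℝ) (n : ℕ) : Measure (Fin n → ℝ) :=
  Measure.pi fun _ => gaussianMixture (prior (G n) n β)

/-- Total variation distance `sup_A |P(A) - Q(A)|` over measurable sets. -/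
def tvDist {Ω : Type*} [MeasurableSpace Ω] (P Q : Measure Ω) : ℝ :=
  sSup {r : ℝ | ∃ A : Set Ω, MeasurableSet A ∧ r = |P.real A - Q.real A|}

/-- The lower critical sparsity level `sup {β ≥ 0 : d_TV → 1}` (it is `0` if there is no such
`β`). -/
def lowerCriticalSparsity (G : ℕ → Measure ℝ) : ℝ :=
  sSup (insert 0 {β : ℝ | 0 ≤ β ∧
    Tendsto (fun n => tvDist (nullLaw n) (altLaw G β n)) atTop (𝓝 1)})

/-- The upper critical sparsity level `inf {0 ≤ β ≤ 1 : d_TV → 0}` (it is `1` if there is no such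
`β`). -/
def upperCriticalSparsity (G : ℕ → Measure ℝ) : ℝ :=
  sInf (insert 1 {β : ℝ | 0 ≤ β ∧ β ≤ 1 ∧
    Tendsto (fun n => tvDist (nullLaw n) (altLaw G β n)) atTop (𝓝 0)})

/-- `b` is the critical sparsity level: both one-sided levels are equal to `b`. -/
def IsCriticalSparsityLevel (G : ℕ → Measure ℝ) (b : ℝ) : Prop :=
  lowerCriticalSparsity G = b ∧ upperCriticalSparsity G = b

/-- `τ_n(δ) = log_n P(|X| > √(2 δ log n))` for one observation `X = μ + Z` with `μ ∼ G n`. -/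
def tau (G : ℕ → Measure ℝ) (n : ℕ) (δ : ℝ) : ℝ :=
  Real.logb n ((gaussianMixture (G n)).real {x : ℝ | √(2 * δ * Real.log n) < |x|})

/-- The statistic of the max test, `maxᵢ |xᵢ|`. -/
def maxStat {n : ℕ} (x : Fin n → ℝ) : ℝ :=
  ⨆ i, |x i|

/-- Critical value of the level-`α` max test: the `1 - α` quantile of `maxᵢ |Xᵢ|` under the
null. -/
def maxCritVal (n : ℕ) (α : ℝ) : ℝ :=
  sInf {t : ℝ | 1 - α ≤ (nullLaw n).real {x | maxStat x ≤ t}}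

/-- Power of the level-`α` max test, which rejects when `maxᵢ |Xᵢ|` exceeds its critical value. -/
def maxTestPower (G : ℕ → Measure ℝ) (β α : ℝ) (n : ℕ) : ℝ :=
  (altLaw G β n).real {x | maxCritVal n α < maxStat x}

/-- `Q` is (eventually positive and) regularly varying at `+∞` with index `γ`. -/
def RegularlyVarying (Q : ℝ → ℝ) (γ : ℝ) : Prop :=
  (∀ᶠ x in atTop, 0 < Q x) ∧
    ∀ t : ℝ, 0 < t → Tendsto (fun x => Q (t * x) / Q x) atTop (𝓝 (t ^ γ))

/-- `-max {log (1 - G(θ)), log G(-θ)}` for the distribution function of `G`. The maximum is taken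
inside the logarithm, so that a tail of mass zero counts as `log 0 = -∞`. -/
def tailExponent (G : Measure ℝ) (θ : ℝ) : ℝ :=
  -Real.log (max (1 - cdf G θ) (cdf G (-θ)))

end SparseMeans

end

noncomputable section

namespace SparseMeans

/-! Let `τ` be the limit of `tau G n`, and put r = √(2 log n). Two bounds on β meet at 1 + τ(1).

Detection: for β < 1 + τ(1) the alternative has about n · n^(-β) · n^τ(1) → ∞ coordinates beyond r
in expectation, while the null has none with probability tending to 1. So the max test has power
tending to 1 (`tendsto_maxTestPower`) and the total variation tends to 1 (`tendsto_tvDist_one`).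

Undetectability: at |x| = √(2δ log n) the likelihood ratio of μ + Z to Z is at most n^(δ + τ_n(δ))
up to logarithms (`likelihoodRatio_le`). The second moment truncated at r is then of order n^(sup(2τ
+ δ)), so n coordinates stay indistinguishable from the null when β > 1/2 + sup(τ(δ) + δ/2) over [0,
1] (`tendsto_tvDist_zero`).

The two bounds agree once τ(δ) + δ/2 is maximal at δ = 1. By `criticalSparsity_eq_one_add_tau` it
suffices that values above c are dominated by the value at 1, with c = 1/4 under (A1) and c = 0
under (A2). Domination rests on a Laplace principle: τ_n(d²) is nearly the maximum over u in [0, 1]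
of log P(mean beyond u·d·r) / log n - d²(1 - u)² (`exists_tau_le`, `eventually_le_tau_one`). Under
(A1) the maximizing mean at level d² is reused at level 1; under (A2) it is moved outwards by the
factor 1/d, at a cost controlled by γ ≤ 2, giving τ(d²) ≤ d² τ(1). -/

/-! ### Gaussian tail bounds -/

/-- On an interval of length 1/(1 + x) to the right of t, the exponent y²/2 grows by at most 1 +
1/2. Since t may be very negative and the prefactor depends on x alone, the bound applies to t = |x|
- |m| uniformly in m. -/
lemma exp_mul_le_gaussianReal_real_Ioi {t x : ℝ} (hx : 0 ≤ x) (htx : t ≤ x) :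
    (Real.exp (-3 / 2) * (√(2 * Real.pi))⁻¹) * ((1 + x)⁻¹ * Real.exp (-t ^ 2 / 2)) ≤
      (gaussianReal 0 1).real (Set.Ioi t) := by
  have hw : 0 < (1 + x)⁻¹ := by positivity
  have hw1 : (1 + x)⁻¹ ≤ 1 := inv_le_one_of_one_le₀ (by linarith)
  have hwx : x * (1 + x)⁻¹ ≤ 1 := by
    rw [← div_eq_mul_inv, div_le_one (by positivity)]; linarith
  have hval : (gaussianReal 0 1).real (Set.Ioc t (t + (1 + x)⁻¹)) =
      ∫ y in Set.Ioc t (t + (1 + x)⁻¹), gaussianPDFReal 0 1 y := by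
    rw [Measure.real, gaussianReal_apply_eq_integral _ one_ne_zero, ENNReal.toReal_ofReal]
    exact integral_nonneg fun y => gaussianPDFReal_nonneg 0 1 y
  calc _ = ∫ _y in Set.Ioc t (t + (1 + x)⁻¹),
        (√(2 * Real.pi))⁻¹ * Real.exp (-3 / 2 + -t ^ 2 / 2) := by
        simp only [integral_const, MeasurableSet.univ, measureReal_restrict_apply, Set.univ_inter,
          Real.volume_real_Ioc, smul_eq_mul]
        rw [max_eq_left (by linarith), Real.exp_add]
        ring
    _ ≤ ∫ y in Set.Ioc t (t + (1 + x)⁻¹), gaussianPDFReal 0 1 y := by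
        refine setIntegral_mono_on (integrable_const _) (integrable_gaussianPDFReal 0 1).integrableOn
          measurableSet_Ioc fun y hy => ?_
        simp only [gaussianPDFReal, NNReal.coe_one, mul_one, sub_zero]
        gcongr
        obtain ⟨h1, h2⟩ := hy
        have h3 : t * (y - t) ≤ 1 :=
          (mul_le_mul_of_nonneg_right htx (by linarith)).trans
            ((mul_le_mul_of_nonneg_left (by linarith) hx).trans hwx)
        have h4 : (y - t) ^ 2 ≤ 1 := by
          have : y - t ≤ 1 := by linarith
          nlinarith
        nlinarith
    _ ≤ _ := by
        rw [← hval]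
        exact measureReal_mono fun y hy => hy.1

lemma gaussianReal_real_Ioi_le_exp {t : ℝ} (ht : 0 ≤ t) :
    (gaussianReal 0 1).real (Set.Ioi t) ≤ Real.exp (-t ^ 2 / 2) := by
  have h := measure_ge_le_exp_mul_mgf (μ := gaussianReal 0 1) (X := id) t ht
    (integrable_exp_mul_gaussianReal t)
  rw [mgf_id_gaussianReal, ← Real.exp_add] at h
  refine (measureReal_mono fun y (hy : t < y) => ?_).trans (h.trans_eq ?_)
  · exact hy.le
  · congr 1; push_cast; ring

/-- The factor 1/t matters: at t = √(2 log n) the exponential alone is exactly 1/n, which would not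
make the expected number of null exceedances vanish. -/
lemma gaussianReal_real_Ioi_le_mills {t : ℝ} (ht : 0 < t) :
    (gaussianReal 0 1).real (Set.Ioi t) ≤ Real.exp (-t ^ 2 / 2) / t := by
  have hval : (gaussianReal 0 1).real (Set.Ioi t) =
      ∫ y in Set.Ioi t, gaussianPDFReal 0 1 y := by
    rw [Measure.real, gaussianReal_apply_eq_integral _ one_ne_zero, ENNReal.toReal_ofReal]
    exact integral_nonneg fun y => gaussianPDFReal_nonneg 0 1 y
  have hint : IntegrableOn (fun y => Real.exp (-t * y)) (Set.Ioi t) :=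
    integrableOn_exp_mul_Ioi (by linarith) t
  rw [hval]
  calc _ ≤ ∫ y in Set.Ioi t, Real.exp (t ^ 2 / 2) * Real.exp (-t * y) := by
        refine setIntegral_mono_on (integrable_gaussianPDFReal 0 1).integrableOn
          (hint.const_mul _) measurableSet_Ioi fun y hy => ?_
        simp only [gaussianPDFReal, NNReal.coe_one, mul_one, sub_zero]
        rw [← Real.exp_add]
        refine (mul_le_of_le_one_left (Real.exp_pos _).le (inv_le_one_of_one_le₀ ?_)).trans ?_
        · rw [Real.one_le_sqrt]; nlinarith [Real.pi_gt_three]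
        · gcongr; nlinarith [sq_nonneg (y - t)]
    _ = _ := by
        rw [integral_const_mul, integral_exp_mul_Ioi (by linarith), neg_div_neg_eq, mul_div_assoc',
          ← Real.exp_add]
        congr 2; ring

lemma gaussianReal_real_Iio_neg (t : ℝ) :
    (gaussianReal 0 1).real (Set.Iio (-t)) = (gaussianReal 0 1).real (Set.Ioi t) := by
  have h := gaussianReal_map_neg (μ := 0) (v := 1)
  rw [neg_zero] at h
  conv_lhs => rw [← h]
  rw [map_measureReal_apply (by fun_prop) measurableSet_Iio]
  congr 1; ext y; simp

lemma measurableSet_lt_abs (t : ℝ) : MeasurableSet {x : ℝ | t < |x|} :=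
  measurableSet_lt measurable_const (by fun_prop)

lemma lt_abs_eq_union (t : ℝ) : {x : ℝ | t < |x|} = Set.Ioi t ∪ Set.Iio (-t) := by
  ext x; simp [lt_abs, lt_neg]

lemma gaussianReal_real_lt_abs_le (t : ℝ) :
    (gaussianReal 0 1).real {x | t < |x|} ≤ 2 * (gaussianReal 0 1).real (Set.Ioi t) := by
  rw [lt_abs_eq_union]
  refine (measureReal_union_le _ _).trans ?_
  rw [gaussianReal_real_Iio_neg]; linarith

/-- The probability that a unit-variance Gaussian with mean `m` exceeds `t` in absolute value is at
least the one-sided tail at `t - |m|`. -/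
lemma gaussianReal_real_Ioi_le_shift (t m : ℝ) :
    (gaussianReal 0 1).real (Set.Ioi (t - |m|)) ≤
      (gaussianReal 0 1).real {z | t < |m + z|} := by
  rcases le_total 0 m with hm | hm
  · rw [abs_of_nonneg hm]
    refine measureReal_mono fun z (hz : t - m < z) => ?_
    exact lt_of_lt_of_le (by linarith) (le_abs_self (m + z))
  · rw [abs_of_nonpos hm, ← gaussianReal_real_Iio_neg]
    refine measureReal_mono fun z (hz : z < -(t - -m)) => ?_
    exact lt_of_lt_of_le (by linarith) (neg_le_abs (m + z))

/-! ### Gaussian mixtures and their likelihood ratio -/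

instance isProbabilityMeasure_gaussianMixture (ν : Measure ℝ) [IsProbabilityMeasure ν] :
    IsProbabilityMeasure (gaussianMixture ν) := by
  unfold gaussianMixture; infer_instance

lemma gaussianMixture_apply (ν : Measure ℝ) [SFinite ν] {s : Set ℝ} (hs : MeasurableSet s) :
    gaussianMixture ν s = ∫⁻ m, gaussianReal 0 1 ((fun z => m + z) ⁻¹' s) ∂ν := by
  rw [gaussianMixture, Measure.conv, Measure.map_apply (by fun_prop) hs,
    Measure.prod_apply (measurable_add hs)]
  rfl

lemma measurable_gaussianReal_preimage_add {s : Set ℝ} (hs : MeasurableSet s) :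
    Measurable fun m : ℝ => gaussianReal 0 1 ((fun z => m + z) ⁻¹' s) :=
  measurable_measure_prodMk_left (measurable_add hs)

lemma gaussianMixture_real (ν : Measure ℝ) [IsProbabilityMeasure ν] {s : Set ℝ}
    (hs : MeasurableSet s) :
    (gaussianMixture ν).real s = ∫ m, (gaussianReal 0 1).real ((fun z => m + z) ⁻¹' s) ∂ν := by
  rw [Measure.real, gaussianMixture_apply ν hs, ← integral_toReal]
  · rfl
  · exact (measurable_gaussianReal_preimage_add hs).aemeasurable
  · exact ae_of_all _ fun m => measure_lt_top _ _

lemma integrable_gaussianReal_real_preimage_add (ν : Measure ℝ) [IsFiniteMeasure ν] {s : Set ℝ}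
    (hs : MeasurableSet s) :
    Integrable (fun m : ℝ => (gaussianReal 0 1).real ((fun z => m + z) ⁻¹' s)) ν := by
  refine Integrable.of_bound
    (measurable_gaussianReal_preimage_add hs).ennreal_toReal.aestronglyMeasurable 1
    (ae_of_all _ fun m => ?_)
  rw [Real.norm_of_nonneg measureReal_nonneg]
  exact measureReal_le_one

/-- The density of `m + Z` with `m ∼ ν` relative to the standard Gaussian. -/
def likelihoodRatio (ν : Measure ℝ) (x : ℝ) : ℝ :=
  ∫ m, Real.exp (m * x - m ^ 2 / 2) ∂ν

lemma integrable_exp_mul_sub_sq (ν : Measure ℝ) [IsFiniteMeasure ν] (x : ℝ) :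
    Integrable (fun m : ℝ => Real.exp (m * x - m ^ 2 / 2)) ν := by
  refine Integrable.of_bound (by fun_prop) (Real.exp (x ^ 2 / 2)) (ae_of_all _ fun m => ?_)
  rw [Real.norm_of_nonneg (Real.exp_pos _).le]
  gcongr; nlinarith [sq_nonneg (m - x)]

lemma likelihoodRatio_nonneg (ν : Measure ℝ) (x : ℝ) : 0 ≤ likelihoodRatio ν x :=
  integral_nonneg fun _ => (Real.exp_pos _).le

lemma measurable_likelihoodRatio (ν : Measure ℝ) [IsFiniteMeasure ν] :
    Measurable (likelihoodRatio ν) := by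
  refine StronglyMeasurable.measurable ?_
  exact StronglyMeasurable.integral_prod_left' (f := fun p : ℝ × ℝ =>
    Real.exp (p.1 * p.2 - p.1 ^ 2 / 2)) (Measurable.stronglyMeasurable (by fun_prop))

lemma gaussianMixture_eq_withDensity (ν : Measure ℝ) [IsFiniteMeasure ν] :
    gaussianMixture ν =
      (gaussianReal 0 1).withDensity fun x => ENNReal.ofReal (likelihoodRatio ν x) := by
  ext s hs
  have hdens : ∀ x : ℝ, ENNReal.ofReal (likelihoodRatio ν x) =
      ∫⁻ m, ENNReal.ofReal (Real.exp (m * x - m ^ 2 / 2)) ∂ν := fun x =>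
    ofReal_integral_eq_lintegral_ofReal (integrable_exp_mul_sub_sq ν x)
      (ae_of_all _ fun m => (Real.exp_pos _).le)
  rw [gaussianMixture_apply ν hs, withDensity_apply _ hs]
  simp_rw [hdens]
  rw [lintegral_lintegral_swap (by fun_prop)]
  refine lintegral_congr fun m => ?_
  have hmap := gaussianReal_map_const_add (μ := 0) (v := 1) m
  rw [← Measure.map_apply (by fun_prop) hs, hmap, zero_add, gaussianReal_apply _ one_ne_zero,
    gaussianReal_of_var_ne_zero _ one_ne_zero,
    setLIntegral_withDensity_eq_setLIntegral_mul _ (measurable_gaussianPDF 0 1) (by fun_prop) hs]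
  refine lintegral_congr fun x => ?_
  simp only [Pi.mul_apply, gaussianPDF]
  rw [← ENNReal.ofReal_mul (gaussianPDFReal_nonneg _ _ _)]
  congr 1
  simp only [gaussianPDFReal, NNReal.coe_one, mul_one, sub_zero]
  rw [mul_assoc, ← Real.exp_add]
  congr 2; ring

/-- Completing the square gives exp(mx - m²/2) ≤ exp(x²/2) exp(-(|x| - |m|)²/2), and the last factor
is, up to C(1 + |x|), a lower bound for the probability that |m + Z| > |x|. Integrating over m turns
a tail probability into a pointwise density bound. -/
lemma likelihoodRatio_le (ν : Measure ℝ) [IsProbabilityMeasure ν] (x : ℝ) :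
    likelihoodRatio ν x ≤ (Real.exp (3 / 2) * √(2 * Real.pi)) * ((1 + |x|) *
      (Real.exp (x ^ 2 / 2) * (gaussianMixture ν).real {y | |x| < |y|})) := by
  rw [gaussianMixture_real ν (measurableSet_lt_abs _), likelihoodRatio, ← integral_const_mul,
    ← integral_const_mul, ← integral_const_mul]
  refine integral_mono (integrable_exp_mul_sub_sq ν x)
    ((((integrable_gaussianReal_real_preimage_add ν (measurableSet_lt_abs _)).const_mul
      _).const_mul _).const_mul _) fun m => ?_
  have h1 := (exp_mul_le_gaussianReal_real_Ioi (abs_nonneg x)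
    (sub_le_self |x| (abs_nonneg m))).trans (gaussianReal_real_Ioi_le_shift |x| m)
  have h2 : Real.exp (m * x - m ^ 2 / 2) ≤
      Real.exp (x ^ 2 / 2) * Real.exp (-(|x| - |m|) ^ 2 / 2) := by
    rw [← Real.exp_add]
    gcongr
    have := le_abs_self (m * x)
    rw [abs_mul] at this
    nlinarith [sq_abs x, sq_abs m]
  have h3 : Real.exp (-3 / 2) = (Real.exp (3 / 2))⁻¹ := by rw [← Real.exp_neg]; norm_num
  have hpi : 0 < √(2 * Real.pi) := by positivity
  refine h2.trans ?_
  have h4 := mul_le_mul_of_nonneg_left h1 (a := (Real.exp (3 / 2) * √(2 * Real.pi)) * ((1 + |x|) *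
      Real.exp (x ^ 2 / 2))) (by positivity)
  refine le_trans (le_of_eq ?_) (h4.trans (le_of_eq ?_))
  · rw [h3]
    have : 0 < 1 + |x| := by positivity
    field_simp
  · simp only [Set.preimage_ofPred_eq]; ring

/-! ### Tails of the distribution of the means -/

/-- `max (P(X > θ), P(X ≤ -θ))`. -/
def tailMax (ν : Measure ℝ) (θ : ℝ) : ℝ := max (1 - cdf ν θ) (cdf ν (-θ))

lemma tailMax_nonneg (ν : Measure ℝ) (θ : ℝ) : 0 ≤ tailMax ν θ :=
  (cdf_nonneg ν _).trans (le_max_right _ _)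

lemma tailMax_le_one (ν : Measure ℝ) (θ : ℝ) : tailMax ν θ ≤ 1 :=
  max_le (by linarith [cdf_nonneg ν θ]) (cdf_le_one ν _)

lemma antitone_tailMax (ν : Measure ℝ) : Antitone (tailMax ν) := fun _ _ h =>
  max_le_max (by linarith [monotone_cdf ν h]) (monotone_cdf ν (neg_le_neg h))

lemma half_le_tailMax_zero (ν : Measure ℝ) : 1 / 2 ≤ tailMax ν 0 := by
  rw [tailMax, neg_zero]
  rcases le_total (cdf ν 0) (1 / 2) with h | h
  · exact le_max_of_le_left (by linarith)
  · exact le_max_of_le_right h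

lemma one_sub_cdf (ν : Measure ℝ) [IsProbabilityMeasure ν] (θ : ℝ) :
    1 - cdf ν θ = ν.real (Set.Ioi θ) := by
  rw [cdf_eq_real, ← probReal_compl_eq_one_sub measurableSet_Iic, Set.compl_Iic]

lemma real_lt_abs_le_tailMax (ν : Measure ℝ) [IsProbabilityMeasure ν] (θ : ℝ) :
    ν.real {m | θ < |m|} ≤ 2 * tailMax ν θ := by
  rw [lt_abs_eq_union]
  refine (measureReal_union_le _ _).trans ?_
  have h1 : ν.real (Set.Ioi θ) ≤ tailMax ν θ := one_sub_cdf ν θ ▸ le_max_left _ _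
  have h2 : ν.real (Set.Iio (-θ)) ≤ tailMax ν θ :=
    (measureReal_mono Set.Iio_subset_Iic_self).trans (cdf_eq_real ν (-θ) ▸ le_max_right _ _)
  linarith

lemma tailMax_mul_le (ν : Measure ℝ) [IsProbabilityMeasure ν] (θ t : ℝ) :
    tailMax ν θ * (gaussianReal 0 1).real (Set.Ioi (t - θ)) ≤
      (gaussianMixture ν).real {x | t < |x|} := by
  have key : ∀ s : Set ℝ, MeasurableSet s → (∀ m ∈ s, θ ≤ |m|) →
      ν.real s * (gaussianReal 0 1).real (Set.Ioi (t - θ)) ≤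
        (gaussianMixture ν).real {x | t < |x|} := by
    intro s hs hsθ
    have hint := integrable_gaussianReal_real_preimage_add ν (measurableSet_lt_abs t)
    rw [gaussianMixture_real ν (measurableSet_lt_abs _)]
    calc _ = ∫ _m in s, (gaussianReal 0 1).real (Set.Ioi (t - θ)) ∂ν := by simp
      _ ≤ ∫ m in s, (gaussianReal 0 1).real ((fun z => m + z) ⁻¹' {x | t < |x|}) ∂ν := by
        refine setIntegral_mono_on (by simp) hint.integrableOn hs fun m hm => ?_
        refine le_trans (measureReal_mono fun z (hz : t - θ < z) => ?_)
          (gaussianReal_real_Ioi_le_shift t m)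
        exact lt_of_le_of_lt (by linarith [hsθ m hm]) hz
      _ ≤ _ := setIntegral_le_integral hint (ae_of_all _ fun m => measureReal_nonneg)
  rcases max_choice (1 - cdf ν θ) (cdf ν (-θ)) with h | h
  · rw [tailMax, h, one_sub_cdf]
    exact key _ measurableSet_Ioi fun m hm => (le_of_lt hm).trans (le_abs_self m)
  · rw [tailMax, h, cdf_eq_real]
    exact key _ measurableSet_Iic fun m hm => (le_neg.2 hm).trans (neg_le_abs m)

/-! ### Second moments of product densities and total variation -/

section ProductMeasures

variable {α : Type*} [MeasurableSpace α]

lemma pi_withDensity_eq (ι : Type*) [Fintype ι] (P : Measure α) [IsProbabilityMeasure P]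
    {f : α → ENNReal} (hf : Measurable f) [SigmaFinite (P.withDensity f)] :
    Measure.pi (fun _ : ι => P.withDensity f) =
      (Measure.pi fun _ : ι => P).withDensity fun x => ∏ i, f (x i) := by
  refine Measure.pi_eq fun s hs => ?_
  have hind : iIndepFun (fun i (x : ι → α) => (s i).indicator f (x i))
      (Measure.pi fun _ : ι => P) :=
    iIndepFun_pi (μ := fun _ : ι => P) (X := fun i => (s i).indicator f)
      fun i => (hf.indicator (hs i)).aemeasurable
  have hprod := lintegral_prod_eq_prod_lintegral_of_indepFun Finset.univ
    (fun i (x : ι → α) => (s i).indicator f (x i)) hind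
    fun i => (hf.indicator (hs i)).comp (measurable_pi_apply i)
  rw [withDensity_apply _ (MeasurableSet.univ_pi hs),
    ← lintegral_indicator (MeasurableSet.univ_pi hs)]
  have hpt : ∀ x : ι → α, (Set.univ.pi s).indicator (fun x => ∏ i, f (x i)) x =
      ∏ i, (s i).indicator f (x i) := by
    intro x
    by_cases hx : x ∈ Set.univ.pi s
    · rw [Set.indicator_of_mem hx]
      exact Finset.prod_congr rfl fun i _ => (Set.indicator_of_mem (hx i trivial) f).symm
    · rw [Set.indicator_of_notMem hx]
      simp only [Set.mem_pi, Set.mem_univ, forall_const, not_forall] at hx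
      obtain ⟨i, hi⟩ := hx
      exact (Finset.prod_eq_zero (Finset.mem_univ i) (Set.indicator_of_notMem hi f)).symm
  simp_rw [hpt]
  rw [hprod]
  refine Finset.prod_congr rfl fun i _ => ?_
  rw [withDensity_apply _ (hs i), ← lintegral_indicator (hs i)]
  exact (measurePreserving_eval (fun _ : ι => P) i).lintegral_comp (hf.indicator (hs i))

/-- With F the product of the minorants g, the difference is at most ∫ |1 - F|, hence at most the L²
norm of 1 - F. The minorant need not have mass 1, which is what permits truncation. -/
lemma pi_real_sub_le (ι : Type*) [Fintype ι] (P : Measure α) [IsProbabilityMeasure P]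
    {f : α → ENNReal} (hf : Measurable f) [IsProbabilityMeasure (P.withDensity f)]
    {g : α → ℝ} (hg : Measurable g) (hg0 : ∀ x, 0 ≤ g x) {B : ℝ} (hgB : ∀ x, g x ≤ B)
    (hgf : ∀ x, ENNReal.ofReal (g x) ≤ f x) {E : Set (ι → α)} (hE : MeasurableSet E) :
    (Measure.pi fun _ : ι => P).real E - (Measure.pi fun _ : ι => P.withDensity f).real E ≤
      √(1 - 2 * (∫ x, g x ∂P) ^ Fintype.card ι + (∫ x, g x ^ 2 ∂P) ^ Fintype.card ι) := by
  set PP := Measure.pi fun _ : ι => P with hPP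
  set F : (ι → α) → ℝ := fun x => ∏ i, g (x i) with hF
  have hFm : Measurable F := Finset.measurable_prod _ fun i _ => hg.comp (measurable_pi_apply i)
  have hF0 : ∀ x, 0 ≤ F x := fun x => Finset.prod_nonneg fun i _ => hg0 _
  have hFB : ∀ x, F x ≤ B ^ Fintype.card ι := fun x => by
    refine (Finset.prod_le_prod (fun i _ => hg0 _) fun i _ => hgB (x i)).trans_eq ?_
    simp
  have hFi : Integrable F PP := Integrable.of_bound hFm.aestronglyMeasurable _
    (ae_of_all _ fun x => (Real.norm_of_nonneg (hF0 x)).trans_le (hFB x))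
  have hF2i : Integrable (fun x => F x ^ 2) PP := by
    refine Integrable.of_bound (hFm.pow_const 2).aestronglyMeasurable
      ((B ^ Fintype.card ι) ^ 2) (ae_of_all _ fun x => ?_)
    rw [Real.norm_of_nonneg (sq_nonneg _)]
    exact pow_le_pow_left₀ (hF0 x) (hFB x) 2
  have hIF : ∫ x, F x ∂PP = (∫ x, g x ∂P) ^ Fintype.card ι := integral_fintype_prod_eq_pow g
  have hIF2 : ∫ x, F x ^ 2 ∂PP = (∫ x, g x ^ 2 ∂P) ^ Fintype.card ι := by
    rw [← integral_fintype_prod_eq_pow (fun x => g x ^ 2)]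
    simp only [hF, Finset.prod_pow]
    rfl
  have hlow : ∫ x in E, F x ∂PP ≤ (Measure.pi fun _ : ι => P.withDensity f).real E := by
    rw [pi_withDensity_eq ι P hf, Measure.real, withDensity_apply _ hE,
      ← ENNReal.ofReal_le_iff_le_toReal, ofReal_integral_eq_lintegral_ofReal hFi.integrableOn
        (ae_of_all _ hF0)]
    · refine lintegral_mono fun x => ?_
      rw [ENNReal.ofReal_prod_of_nonneg fun i _ => hg0 _]
      exact Finset.prod_le_prod' fun i _ => hgf _
    · rw [← withDensity_apply _ hE, ← pi_withDensity_eq ι P hf]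
      exact measure_ne_top _ _
  have h1 : PP.real E - ∫ x in E, F x ∂PP = ∫ x in E, (1 - F x) ∂PP := by
    rw [integral_sub (integrable_const _) hFi.integrableOn]; simp
  have hsq : Integrable (fun x => (1 - F x) ^ 2) PP := by
    have : (fun x => (1 - F x) ^ 2) = fun x => 1 - 2 * F x + F x ^ 2 := by ext x; ring
    rw [this]
    exact ((integrable_const _).sub (hFi.const_mul 2)).add hF2i
  have habs : Integrable (fun x => |1 - F x|) PP := ((integrable_const _).sub hFi).abs
  have h2 : ∫ x in E, (1 - F x) ∂PP ≤ ∫ x, |1 - F x| ∂PP :=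
    (integral_mono ((integrable_const _).sub hFi).integrableOn habs.integrableOn
      fun x => le_abs_self _).trans
      (setIntegral_le_integral habs (ae_of_all _ fun x => abs_nonneg _))
  have h3 : (∫ x, |1 - F x| ∂PP) ^ 2 ≤ ∫ x, (1 - F x) ^ 2 ∂PP := by
    have hmem : MemLp (fun x => |1 - F x|) 2 PP := by
      rw [memLp_two_iff_integrable_sq habs.aestronglyMeasurable]
      simpa only [sq_abs] using hsq
    -- Jensen's inequality, in the form that the variance is nonnegative.
    have hv := variance_nonneg (fun x => |1 - F x|) PP
    rw [variance_eq_sub hmem] at hv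
    simpa [sq_abs] using hv
  have h4 : ∫ x, (1 - F x) ^ 2 ∂PP = 1 - 2 * (∫ x, F x ∂PP) + ∫ x, F x ^ 2 ∂PP := by
    have : ∀ x, (1 - F x) ^ 2 = 1 - 2 * F x + F x ^ 2 := fun x => by ring
    simp_rw [this]
    rw [integral_add (f := fun x => 1 - 2 * F x)
      ((integrable_const _).sub (hFi.const_mul 2)) hF2i, integral_sub (integrable_const _) (hFi.const_mul 2), integral_const_mul]
    simp
  rw [← hIF, ← hIF2, ← h4]
  have h5 := Real.le_sqrt_of_sq_le h3
  linarith

end ProductMeasures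

section TotalVariation

variable {Ω : Type*} [MeasurableSpace Ω] (P Q : Measure Ω) [IsProbabilityMeasure P]
  [IsProbabilityMeasure Q]

lemma tvDist_le_of_real_sub_le {r : ℝ} (h : ∀ A, MeasurableSet A → P.real A - Q.real A ≤ r) :
    tvDist P Q ≤ r := by
  refine csSup_le ⟨_, ∅, MeasurableSet.empty, rfl⟩ ?_
  rintro _ ⟨A, hA, rfl⟩
  refine abs_sub_le_iff.2 ⟨h A hA, ?_⟩
  have := h Aᶜ hA.compl
  rw [probReal_compl_eq_one_sub hA, probReal_compl_eq_one_sub hA] at this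
  linarith

lemma tvDist_le_one : tvDist P Q ≤ 1 :=
  tvDist_le_of_real_sub_le P Q fun A _ => by
    linarith [measureReal_le_one (μ := P) (s := A), measureReal_nonneg (μ := Q) (s := A)]

lemma abs_real_sub_le_tvDist {A : Set Ω} (hA : MeasurableSet A) :
    |P.real A - Q.real A| ≤ tvDist P Q := by
  refine le_csSup ⟨1, ?_⟩ ⟨A, hA, rfl⟩
  rintro _ ⟨A, _, rfl⟩
  exact abs_sub_le_iff.2
    ⟨by linarith [measureReal_le_one (μ := P) (s := A), measureReal_nonneg (μ := Q) (s := A)],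
      by linarith [measureReal_le_one (μ := Q) (s := A), measureReal_nonneg (μ := P) (s := A)]⟩

lemma tvDist_nonneg : 0 ≤ tvDist P Q :=
  (abs_nonneg _).trans (abs_real_sub_le_tvDist P Q MeasurableSet.empty)

end TotalVariation

/-! ### The sparse prior and the truncated second moment -/

lemma rpow_neg_mem_Icc {n : ℕ} (hn : 1 ≤ n) {β : ℝ} (hβ : 0 ≤ β) :
    0 ≤ (n : ℝ) ^ (-β) ∧ (n : ℝ) ^ (-β) ≤ 1 :=
  ⟨by positivity, Real.rpow_le_one_of_one_le_of_nonpos (by exact_mod_cast hn) (by linarith)⟩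

lemma isProbabilityMeasure_prior (ν : Measure ℝ) [IsProbabilityMeasure ν] {n : ℕ} (hn : 1 ≤ n)
    {β : ℝ} (hβ : 0 ≤ β) : IsProbabilityMeasure (prior ν n β) := by
  obtain ⟨h0, h1⟩ := rpow_neg_mem_Icc hn hβ
  constructor
  simp only [prior, Measure.add_apply, Measure.smul_apply, measure_univ, smul_eq_mul, mul_one]
  rw [← ENNReal.ofReal_add (by linarith) h0]
  simp

lemma likelihoodRatio_prior (ν : Measure ℝ) [IsProbabilityMeasure ν] {n : ℕ} (hn : 1 ≤ n)
    {β : ℝ} (hβ : 0 ≤ β) (x : ℝ) :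
    likelihoodRatio (prior ν n β) x =
      (1 - (n : ℝ) ^ (-β)) + (n : ℝ) ^ (-β) * likelihoodRatio ν x := by
  obtain ⟨h0, h1⟩ := rpow_neg_mem_Icc hn hβ
  rw [likelihoodRatio, prior, integral_add_measure, integral_smul_measure, integral_smul_measure,
    integral_dirac, ENNReal.toReal_ofReal (by linarith), ENNReal.toReal_ofReal h0]
  · simp [likelihoodRatio]
  · exact (integrable_exp_mul_sub_sq (Measure.dirac 0) x).smul_measure ENNReal.ofReal_ne_top
  · exact (integrable_exp_mul_sub_sq ν x).smul_measure ENNReal.ofReal_ne_top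

lemma gaussianMixture_prior_real (ν : Measure ℝ) [IsProbabilityMeasure ν] {n : ℕ} (hn : 1 ≤ n)
    {β : ℝ} (hβ : 0 ≤ β) {s : Set ℝ} (hs : MeasurableSet s) :
    (gaussianMixture (prior ν n β)).real s = (1 - (n : ℝ) ^ (-β)) * (gaussianReal 0 1).real s +
      (n : ℝ) ^ (-β) * (gaussianMixture ν).real s := by
  obtain ⟨h0, h1⟩ := rpow_neg_mem_Icc hn hβ
  have := isProbabilityMeasure_prior ν hn hβ
  rw [gaussianMixture_real _ hs, gaussianMixture_real _ hs, prior, integral_add_measure,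
    integral_smul_measure, integral_smul_measure,
    integral_dirac, ENNReal.toReal_ofReal (by linarith), ENNReal.toReal_ofReal h0]
  · simp
  · exact (integrable_gaussianReal_real_preimage_add (Measure.dirac 0) hs).smul_measure
      ENNReal.ofReal_ne_top
  · exact (integrable_gaussianReal_real_preimage_add ν hs).smul_measure ENNReal.ofReal_ne_top

lemma integrable_likelihoodRatio (ν : Measure ℝ) [IsFiniteMeasure ν] :
    Integrable (likelihoodRatio ν) (gaussianReal 0 1) := by
  refine ⟨(measurable_likelihoodRatio ν).aestronglyMeasurable, ?_⟩
  rw [hasFiniteIntegral_iff_ofReal (ae_of_all _ (likelihoodRatio_nonneg ν)),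
    ← setLIntegral_univ, ← withDensity_apply _ MeasurableSet.univ,
    ← gaussianMixture_eq_withDensity]
  unfold gaussianMixture
  exact measure_lt_top _ _

lemma gaussianMixture_real_eq_setIntegral (ν : Measure ℝ) [IsFiniteMeasure ν] {s : Set ℝ}
    (hs : MeasurableSet s) :
    (gaussianMixture ν).real s = ∫ x in s, likelihoodRatio ν x ∂gaussianReal 0 1 := by
  rw [gaussianMixture_eq_withDensity, Measure.real, withDensity_apply _ hs,
    ← ofReal_integral_eq_lintegral_ofReal (integrable_likelihoodRatio ν).integrableOn
      (ae_of_all _ (likelihoodRatio_nonneg ν)),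
    ENNReal.toReal_ofReal (integral_nonneg (likelihoodRatio_nonneg ν))]

lemma likelihoodRatio_le_exp (ν : Measure ℝ) [IsProbabilityMeasure ν] (x : ℝ) :
    likelihoodRatio ν x ≤ Real.exp (x ^ 2 / 2) := by
  have := integral_mono (integrable_exp_mul_sub_sq ν x) (integrable_const (Real.exp (x ^ 2 / 2)))
    fun m => Real.exp_le_exp.2 (by nlinarith [sq_nonneg (m - x)] : m * x - m ^ 2 / 2 ≤ x ^ 2 / 2)
  simpa [likelihoodRatio] using this

lemma altLaw_eq_pi_withDensity (G : ℕ → Measure ℝ) (hprob : ∀ n, IsProbabilityMeasure (G n))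
    {n : ℕ} (hn : 1 ≤ n) {β : ℝ} (hβ : 0 ≤ β) :
    altLaw G β n = Measure.pi fun _ : Fin n => (gaussianReal 0 1).withDensity fun x =>
      ENNReal.ofReal (likelihoodRatio (prior (G n) n β) x) := by
  have := isProbabilityMeasure_prior (G n) hn hβ
  rw [altLaw, gaussianMixture_eq_withDensity]

instance isProbabilityMeasure_nullLaw (n : ℕ) : IsProbabilityMeasure (nullLaw n) := by
  unfold nullLaw; infer_instance

lemma isProbabilityMeasure_altLaw (G : ℕ → Measure ℝ) (hprob : ∀ n, IsProbabilityMeasure (G n))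
    {n : ℕ} (hn : 1 ≤ n) {β : ℝ} (hβ : 0 ≤ β) : IsProbabilityMeasure (altLaw G β n) := by
  have := isProbabilityMeasure_prior (G n) hn hβ
  unfold altLaw; infer_instance

/-- Truncated second moment bound for the total variation distance. -/
lemma tvDist_le_truncated (G : ℕ → Measure ℝ) (hprob : ∀ n, IsProbabilityMeasure (G n))
    {n : ℕ} (hn : 1 ≤ n) {β : ℝ} (hβ : 0 ≤ β) (r : ℝ) :
    tvDist (nullLaw n) (altLaw G β n) ≤
      √(1 - 2 * (1 - (n : ℝ) ^ (-β) * (gaussianMixture (G n)).real {x | r < |x|}) ^ n +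
        (1 + ((n : ℝ) ^ (-β)) ^ 2 *
          ∫ x in {x | |x| ≤ r}, likelihoodRatio (G n) x ^ 2 ∂gaussianReal 0 1) ^ n) := by
  have := isProbabilityMeasure_altLaw G hprob hn hβ
  have := isProbabilityMeasure_prior (G n) hn hβ
  obtain ⟨hp0, hp1⟩ := rpow_neg_mem_Icc hn hβ
  set p : ℝ := (n : ℝ) ^ (-β)
  set h := likelihoodRatio (G n)
  set A : Set ℝ := {x | |x| ≤ r}
  have hA : MeasurableSet A := measurableSet_le (by fun_prop) measurable_const
  have hAc : {x : ℝ | r < |x|} = Aᶜ := by ext; simp [A]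
  have hh0 : ∀ x, 0 ≤ h x := likelihoodRatio_nonneg _
  have hhm : Measurable h := measurable_likelihoodRatio _
  have hi0 : ∀ x, 0 ≤ A.indicator h x := Set.indicator_nonneg fun x _ => hh0 x
  have him : Measurable (A.indicator h) := hhm.indicator hA
  have hiB : ∀ x, A.indicator h x ≤ Real.exp (r ^ 2 / 2) := by
    refine fun x => Set.indicator_le' (f := h) (g := fun _ => Real.exp (r ^ 2 / 2))
      (fun x hx => (likelihoodRatio_le_exp (G n) x).trans ?_) (fun x _ => (Real.exp_pos _).le) x
    have := sq_le_sq.2 ((show |x| ≤ r from hx).trans (le_abs_self r))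
    exact Real.exp_le_exp.2 (by linarith)
  have hint : Integrable (A.indicator h) (gaussianReal 0 1) :=
    (integrable_likelihoodRatio (G n)).indicator hA
  have hint2 : Integrable (fun x => A.indicator h x ^ 2) (gaussianReal 0 1) := by
    refine Integrable.of_bound (him.pow_const 2).aestronglyMeasurable
      (Real.exp (r ^ 2 / 2) ^ 2) (ae_of_all _ fun x => ?_)
    rw [Real.norm_of_nonneg (sq_nonneg _)]
    exact pow_le_pow_left₀ (hi0 x) (hiB x) 2
  have hI1 : ∫ x, A.indicator h x ∂gaussianReal 0 1 =
      1 - (gaussianMixture (G n)).real {x | r < |x|} := by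
    rw [hAc, probReal_compl_eq_one_sub hA, integral_indicator hA,
      gaussianMixture_real_eq_setIntegral _ hA]
    ring
  have hI2 : ∫ x, A.indicator h x ^ 2 ∂gaussianReal 0 1 =
      ∫ x in A, h x ^ 2 ∂gaussianReal 0 1 := by
    rw [← integral_indicator hA]
    congr 1; ext x
    by_cases hx : x ∈ A <;> simp [hx]
  set a := (gaussianMixture (G n)).real {x | r < |x|}
  have ha0 : 0 ≤ a := measureReal_nonneg
  have ha1 : a ≤ 1 := measureReal_le_one
  -- Only the nonnull component is truncated, so the lost mass is p · a rather than a multiple of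
  -- the null tail.
  set g : ℝ → ℝ := fun x => (1 - p) + p * A.indicator h x with hg
  have hgm : Measurable g := (him.const_mul p).const_add _
  have hg0 : ∀ x, 0 ≤ g x := fun x => add_nonneg (by linarith) (mul_nonneg hp0 (hi0 x))
  have hgB : ∀ x, g x ≤ (1 - p) + p * Real.exp (r ^ 2 / 2) := fun x => by
    simp only [hg]; gcongr; exact hiB x
  have hm : ∫ x, g x ∂gaussianReal 0 1 = 1 - p * a := by
    simp only [hg]
    rw [integral_add (integrable_const _) (hint.const_mul p), integral_const_mul, hI1]
    simp only [integral_const, probReal_univ, smul_eq_mul]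
    ring
  have hs : ∫ x, g x ^ 2 ∂gaussianReal 0 1 ≤
      1 + p ^ 2 * ∫ x in A, h x ^ 2 ∂gaussianReal 0 1 := by
    have hexp : ∀ x, g x ^ 2 = ((1 - p) ^ 2 + 2 * (1 - p) * p * A.indicator h x) +
        p ^ 2 * A.indicator h x ^ 2 := fun x => by simp only [hg]; ring
    simp_rw [hexp]
    rw [integral_add (f := fun x => (1 - p) ^ 2 + 2 * (1 - p) * p * A.indicator h x)
      ((integrable_const _).add (hint.const_mul _)) (hint2.const_mul _),
      integral_add (integrable_const _) (hint.const_mul _), integral_const_mul,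
      integral_const_mul, hI1, hI2]
    simp only [integral_const, probReal_univ, smul_eq_mul, one_mul]
    -- The terms free of h² sum to at most (1 - p)² + 2(1 - p)p = 1 - p² ≤ 1.
    have : 0 ≤ (1 - p) * p := mul_nonneg (by linarith) hp0
    nlinarith
  have hgf : ∀ x, ENNReal.ofReal (g x) ≤
      ENNReal.ofReal (likelihoodRatio (prior (G n) n β) x) := fun x => by
    rw [likelihoodRatio_prior (G n) hn hβ]
    refine ENNReal.ofReal_le_ofReal ?_
    simp only [hg]
    gcongr
    exact Set.indicator_le_self' (fun x _ => hh0 x) x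
  have hfm : Measurable fun x => ENNReal.ofReal (likelihoodRatio (prior (G n) n β) x) :=
    (measurable_likelihoodRatio _).ennreal_ofReal
  have hQ : IsProbabilityMeasure ((gaussianReal 0 1).withDensity fun x =>
      ENNReal.ofReal (likelihoodRatio (prior (G n) n β) x)) := by
    rw [← gaussianMixture_eq_withDensity]; infer_instance
  refine tvDist_le_of_real_sub_le _ _ fun E hE => ?_
  rw [altLaw_eq_pi_withDensity G hprob hn hβ]
  refine (pi_real_sub_le (Fin n) (gaussianReal 0 1) hfm hgm hg0 hgB hgf hE).trans ?_
  rw [hm, Fintype.card_fin]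
  gcongr

/-! ### Distribution of the max statistic -/

lemma maxStat_le_iff {n : ℕ} (hn : 1 ≤ n) (x : Fin n → ℝ) (r : ℝ) :
    maxStat x ≤ r ↔ ∀ i, |x i| ≤ r := by
  have : Nonempty (Fin n) := ⟨⟨0, hn⟩⟩
  exact ciSup_le_iff (Set.finite_range _).bddAbove

lemma setOf_maxStat_le {n : ℕ} (hn : 1 ≤ n) (r : ℝ) :
    {x : Fin n → ℝ | maxStat x ≤ r} = Set.univ.pi fun _ => {y : ℝ | |y| ≤ r} := by
  ext x; simp [maxStat_le_iff hn]

lemma measurableSet_abs_le (r : ℝ) : MeasurableSet {y : ℝ | |y| ≤ r} :=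
  measurableSet_le (by fun_prop) measurable_const

lemma measurableSet_maxStat_le {n : ℕ} (hn : 1 ≤ n) (r : ℝ) :
    MeasurableSet {x : Fin n → ℝ | maxStat x ≤ r} := by
  rw [setOf_maxStat_le hn]
  exact MeasurableSet.univ_pi fun _ => measurableSet_abs_le r

lemma compl_setOf_lt_maxStat {n : ℕ} (r : ℝ) :
    {x : Fin n → ℝ | r < maxStat x} = {x : Fin n → ℝ | maxStat x ≤ r}ᶜ := by
  ext; simp

lemma pi_real_maxStat_le (P : Measure ℝ) [IsProbabilityMeasure P] {n : ℕ} (hn : 1 ≤ n) (r : ℝ) :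
    (Measure.pi fun _ : Fin n => P).real {x | maxStat x ≤ r} =
      (1 - P.real {y | r < |y|}) ^ n := by
  rw [setOf_maxStat_le hn, Measure.real, Measure.pi_pi]
  have : {y : ℝ | r < |y|} = {y : ℝ | |y| ≤ r}ᶜ := by ext; simp
  rw [this, probReal_compl_eq_one_sub (measurableSet_abs_le r), Finset.prod_const,
    ENNReal.toReal_pow]
  simp [Measure.real]

lemma altLaw_real_maxStat_le_exp (G : ℕ → Measure ℝ) (hprob : ∀ n, IsProbabilityMeasure (G n))
    {n : ℕ} (hn : 1 ≤ n) {β : ℝ} (hβ : 0 ≤ β) (r : ℝ) :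
    (altLaw G β n).real {x | maxStat x ≤ r} ≤
      Real.exp (-(n * (n : ℝ) ^ (-β) * (gaussianMixture (G n)).real {x | r < |x|})) := by
  have := isProbabilityMeasure_prior (G n) hn hβ
  obtain ⟨hp0, hp1⟩ := rpow_neg_mem_Icc hn hβ
  rw [altLaw, pi_real_maxStat_le _ hn]
  set q := (gaussianMixture (prior (G n) n β)).real {x | r < |x|} with hq
  have hq1 : q ≤ 1 := measureReal_le_one
  have hqa : (n : ℝ) ^ (-β) * (gaussianMixture (G n)).real {x | r < |x|} ≤ q := by
    rw [hq, gaussianMixture_prior_real (G n) hn hβ (measurableSet_lt_abs r)]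
    have : 0 ≤ (1 - (n : ℝ) ^ (-β)) * (gaussianReal 0 1).real {x | r < |x|} :=
      mul_nonneg (by linarith) measureReal_nonneg
    linarith
  calc (1 - q) ^ n ≤ Real.exp (-q) ^ n :=
        pow_le_pow_left₀ (by linarith) (Real.one_sub_le_exp_neg q) n
    _ = Real.exp (-(n * q)) := by rw [← Real.exp_nat_mul]; congr 1; ring
    _ ≤ _ := by
      rw [mul_assoc]; gcongr

lemma one_sub_le_nullLaw_real_maxStat_le {n : ℕ} (hn : 1 ≤ n) (r : ℝ) :
    1 - n * (gaussianReal 0 1).real {x | r < |x|} ≤ (nullLaw n).real {x | maxStat x ≤ r} := by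
  rw [nullLaw, pi_real_maxStat_le _ hn]
  have h1 : (gaussianReal 0 1).real {x | r < |x|} ≤ 1 := measureReal_le_one
  have := one_add_mul_le_pow (a := -(gaussianReal 0 1).real {x | r < |x|}) (by linarith) n
  refine le_trans (le_of_eq ?_) (this.trans (le_of_eq ?_)) <;> ring

lemma maxCritVal_le {n : ℕ} (hn : 1 ≤ n) {α r : ℝ} (hα : α < 1)
    (h : n * (gaussianReal 0 1).real {x | r < |x|} ≤ α) : maxCritVal n α ≤ r := by
  refine csInf_le ⟨0, fun t (ht : 1 - α ≤ _) => ?_⟩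
    (le_trans (by linarith) (one_sub_le_nullLaw_real_maxStat_le hn r))
  -- `csInf_le` needs the set of levels to be bounded below: a negative level has null probability 0
  -- < 1 - α.
  by_contra! hneg
  have hempty : {x : Fin n → ℝ | maxStat x ≤ t} = ∅ := by
    refine Set.eq_empty_of_forall_notMem fun x hx => ?_
    have := (maxStat_le_iff hn x t).1 hx ⟨0, hn⟩
    linarith [abs_nonneg (x ⟨0, hn⟩)]
  rw [hempty, measureReal_empty] at ht
  linarith

/-! ### The tail exponent of an observation -/

lemma gaussianMixture_real_lt_abs_pos (ν : Measure ℝ) [IsProbabilityMeasure ν] (t : ℝ) :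
    0 < (gaussianMixture ν).real {x | t < |x|} := by
  have h1 := tailMax_mul_le ν 0 t
  have h2 := half_le_tailMax_zero ν
  have h3 := exp_mul_le_gaussianReal_real_Ioi (abs_nonneg t) (le_abs_self t)
  have h4 : 0 < (gaussianReal 0 1).real (Set.Ioi t) := lt_of_lt_of_le (by positivity) h3
  rw [sub_zero] at h1
  exact lt_of_lt_of_le (mul_pos (by linarith) h4) h1

lemma rpow_tau (G : ℕ → Measure ℝ) (hprob : ∀ n, IsProbabilityMeasure (G n))
    {n : ℕ} (hn : 2 ≤ n) (δ : ℝ) :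
    (n : ℝ) ^ tau G n δ = (gaussianMixture (G n)).real {x | √(2 * δ * Real.log n) < |x|} := by
  have hn' : (2 : ℝ) ≤ n := by exact_mod_cast hn
  exact Real.rpow_logb (by linarith) (by linarith) (gaussianMixture_real_lt_abs_pos _ _)

lemma tau_nonpos (G : ℕ → Measure ℝ) (hprob : ∀ n, IsProbabilityMeasure (G n))
    {n : ℕ} (hn : 2 ≤ n) (δ : ℝ) : tau G n δ ≤ 0 := by
  have hn' : (2 : ℝ) ≤ n := by exact_mod_cast hn
  exact Real.logb_nonpos (by linarith) measureReal_nonneg measureReal_le_one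

lemma tau_mul_log (G : ℕ → Measure ℝ) {n : ℕ} (hn : 2 ≤ n) (δ : ℝ) : tau G n δ * Real.log n =
    Real.log ((gaussianMixture (G n)).real {x | √(2 * δ * Real.log n) < |x|}) := by
  have hn' : (2 : ℝ) ≤ n := by exact_mod_cast hn
  exact div_mul_cancel₀ _ (Real.log_pos (by linarith)).ne'

/-- At x² = 2δ log n the Gaussian density is at most n^(-δ) and the likelihood ratio at most C(1 +
|x|) n^(δ + τ_n(δ)), so the integrand is bounded by n^(2τ_n(δ) + δ) up to a power of log n. The
interval of integration adds one more factor of order √(log n). -/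
lemma setIntegral_likelihoodRatio_sq_le (G : ℕ → Measure ℝ) (hprob : ∀ n, IsProbabilityMeasure (G n))
    {n : ℕ} (hn : 2 ≤ n) {B : ℝ}
    (hB : ∀ δ ∈ Set.Icc (0 : ℝ) 1, (n : ℝ) ^ (2 * tau G n δ + δ) ≤ B) :
    ∫ x in {x | |x| ≤ √(2 * 1 * Real.log n)}, likelihoodRatio (G n) x ^ 2 ∂gaussianReal 0 1 ≤
      2 * (Real.exp (3 / 2) * √(2 * Real.pi)) ^ 2 *
        ((1 + √(2 * 1 * Real.log n)) ^ 3 * B) := by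
  have hn' : (2 : ℝ) ≤ n := by exact_mod_cast hn
  have hlog : 0 < Real.log n := Real.log_pos (by linarith)
  set r := √(2 * 1 * Real.log n) with hr
  have hr0 : 0 ≤ r := Real.sqrt_nonneg _
  have hr2 : r ^ 2 = 2 * Real.log n := by rw [hr, Real.sq_sqrt (by positivity)]; ring
  set C := Real.exp (3 / 2) * √(2 * Real.pi) with hC
  have hC0 : 0 ≤ C := by positivity
  have hA : {x : ℝ | |x| ≤ r} = Set.Icc (-r) r := by ext; simp [abs_le]
  have hB0 : 0 ≤ B := le_trans (by positivity) (hB 0 (by simp))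
  rw [gaussianReal_of_var_ne_zero _ one_ne_zero, hA]
  have hconv : ∫ x in Set.Icc (-r) r, likelihoodRatio (G n) x ^ 2
      ∂(volume.withDensity (gaussianPDF 0 1)) =
      ∫ x in Set.Icc (-r) r, gaussianPDFReal 0 1 x * likelihoodRatio (G n) x ^ 2 := by
    rw [setIntegral_withDensity_eq_setIntegral_toReal_smul (measurable_gaussianPDF 0 1)
      (ae_of_all _ fun x => gaussianPDF_lt_top) _ measurableSet_Icc]
    simp [toReal_gaussianPDF]
  rw [hconv]
  calc _ ≤ ∫ _x in Set.Icc (-r) r, C ^ 2 * ((1 + r) ^ 2 * B) := by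
        refine integral_mono_of_nonneg
          (ae_of_all _ fun x => mul_nonneg (gaussianPDFReal_nonneg _ _ _) (sq_nonneg _))
          (integrable_const _) ((ae_restrict_iff' measurableSet_Icc).2
          (ae_of_all _ fun x hx => ?_))
        have hxr : |x| ≤ r := abs_le.2 hx
        set δ := x ^ 2 / (2 * Real.log n) with hδ
        have hx2 : x ^ 2 ≤ r ^ 2 := sq_le_sq.2 (hxr.trans (le_abs_self r))
        have hδ01 : δ ∈ Set.Icc (0 : ℝ) 1 :=
          ⟨by positivity, by rw [hδ, div_le_one (by positivity), ← hr2]; exact hx2⟩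
        have hδx : 2 * δ * Real.log n = x ^ 2 := by rw [hδ]; field_simp
        have hS := rpow_tau G hprob hn δ
        rw [hδx, Real.sqrt_sq_eq_abs] at hS
        have hlr := likelihoodRatio_le (G n) x
        rw [← hS] at hlr
        have hexp : Real.exp (x ^ 2 / 2) = (n : ℝ) ^ δ := by
          rw [Real.rpow_def_of_pos (by linarith), ← hδx]; congr 1; ring
        have hpdf : gaussianPDFReal 0 1 x ≤ ((n : ℝ) ^ δ)⁻¹ := by
          rw [← hexp, ← Real.exp_neg]
          simp only [gaussianPDFReal, NNReal.coe_one, mul_one, sub_zero]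
          refine (mul_le_of_le_one_left (Real.exp_pos _).le (inv_le_one_of_one_le₀ ?_)).trans
            (le_of_eq (by ring_nf))
          rw [Real.one_le_sqrt]; nlinarith [Real.pi_gt_three]
        rw [hexp] at hlr
        have hnδ : 0 < (n : ℝ) ^ δ := by positivity
        calc gaussianPDFReal 0 1 x * likelihoodRatio (G n) x ^ 2
            ≤ ((n : ℝ) ^ δ)⁻¹ * (C * ((1 + |x|) * ((n : ℝ) ^ δ * (n : ℝ) ^ tau G n δ))) ^ 2 := by
              gcongr
              exact likelihoodRatio_nonneg _ _
          _ = C ^ 2 * ((1 + |x|) ^ 2 * (n : ℝ) ^ (2 * tau G n δ + δ)) := by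
              rw [Real.rpow_add (by linarith), two_mul, Real.rpow_add (by linarith)]
              field_simp
          _ ≤ C ^ 2 * ((1 + r) ^ 2 * B) := by
              gcongr
              exact hB δ hδ01
    _ = 2 * r * (C ^ 2 * ((1 + r) ^ 2 * B)) := by
        rw [setIntegral_const, Real.volume_real_Icc_of_le (by linarith), smul_eq_mul]; ring
    _ ≤ 2 * (1 + r) * (C ^ 2 * ((1 + r) ^ 2 * B)) := by gcongr; linarith
    _ = _ := by ring

/-! ### Undetectability -/

lemma tendsto_log_natCast : Tendsto (fun n : ℕ => Real.log n) atTop atTop :=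
  Real.tendsto_log_atTop.comp tendsto_natCast_atTop_atTop

lemma tendsto_natCast_rpow_neg {s : ℝ} (hs : 0 < s) :
    Tendsto (fun n : ℕ => (n : ℝ) ^ (-s)) atTop (𝓝 0) :=
  (tendsto_rpow_neg_atTop hs).comp tendsto_natCast_atTop_atTop

lemma tendsto_log_mul_rpow_neg {s : ℝ} (hs : 0 < s) :
    Tendsto (fun n : ℕ => (2 + Real.log n) * (n : ℝ) ^ (-s)) atTop (𝓝 0) := by
  have h1 : Tendsto (fun n : ℕ => Real.log n / (n : ℝ) ^ s) atTop (𝓝 0) :=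
    ((isLittleO_log_rpow_atTop hs).tendsto_div_nhds_zero).comp tendsto_natCast_atTop_atTop
  have h2 := ((tendsto_natCast_rpow_neg hs).const_mul 2).add h1
  rw [mul_zero, add_zero] at h2
  refine h2.congr fun n => ?_
  rw [Real.rpow_neg (by positivity)]; ring

lemma one_add_sqrt_two_mul_le {y : ℝ} (hy : 0 ≤ y) : 1 + √(2 * 1 * y) ≤ 2 + y := by
  have : √(2 * 1 * y) ≤ 1 + y := Real.sqrt_le_iff.2 ⟨by linarith, by nlinarith⟩
  linarith

/-- Undetectability above the level `1/2 + M` whenever `τ(δ) + δ/2 ≤ M` on `[0, 1]`. -/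
lemma tendsto_tvDist_zero (G : ℕ → Measure ℝ) (hprob : ∀ n, IsProbabilityMeasure (G n))
    {τ : ℝ → ℝ} (hτ : TendstoUniformlyOn (tau G) τ atTop (Set.Icc (0 : ℝ) 1))
    {M : ℝ} (hM : ∀ δ ∈ Set.Icc (0 : ℝ) 1, τ δ + δ / 2 ≤ M) {β : ℝ} (hβ0 : 0 ≤ β)
    (hβ : 1 / 2 + M < β) :
    Tendsto (fun n => tvDist (nullLaw n) (altLaw G β n)) atTop (𝓝 0) := by
  obtain ⟨ε, hε, hεβ⟩ : ∃ ε, 0 < ε ∧ β = 1 / 2 + M + 2 * ε :=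
    ⟨(β - 1 / 2 - M) / 2, by linarith, by ring⟩
  set C := 2 * (Real.exp (3 / 2) * √(2 * Real.pi)) ^ 2
  have hC : 0 ≤ C := by positivity
  -- The first term is the truncation loss. In the second, n · n^(-2β) · n^(2M + 2ε) = n^(-2ε),
  -- written as a cube to absorb the factor (2 + log n)³.
  have hlim : Tendsto (fun n : ℕ => √(2 * (n : ℝ) ^ (-ε) +
      (Real.exp (C * ((2 + Real.log n) * (n : ℝ) ^ (-(2 * ε / 3))) ^ 3) - 1))) atTop (𝓝 0) := by
    have h1 := (tendsto_natCast_rpow_neg hε).const_mul 2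
    have h2 := ((tendsto_log_mul_rpow_neg (s := 2 * ε / 3) (by positivity)).pow 3).const_mul C
    have h3 := ((Real.continuous_exp.tendsto _).comp h2).sub_const 1
    have h4 := (Real.continuous_sqrt.tendsto _).comp (h1.add h3)
    simpa [Function.comp_def] using h4
  refine squeeze_zero' ?_ ?_ hlim
  · filter_upwards [eventually_ge_atTop 1] with n hn
    have := isProbabilityMeasure_altLaw G hprob hn hβ0
    exact tvDist_nonneg _ _
  · filter_upwards [eventually_ge_atTop 2, Metric.tendstoUniformlyOn_iff.1 hτ ε hε] with n hn hun
    have hn' : (2 : ℝ) ≤ n := by exact_mod_cast hn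
    have hn0 : (0 : ℝ) < n := by linarith
    have hn1 : (1 : ℝ) ≤ n := by linarith
    have hτn : ∀ δ ∈ Set.Icc (0 : ℝ) 1, tau G n δ ≤ τ δ + ε := fun δ hδ => by
      have := hun δ hδ
      rw [Real.dist_eq, abs_lt] at this
      linarith
    have hH := setIntegral_likelihoodRatio_sq_le G hprob hn (B := (n : ℝ) ^ (2 * M + 2 * ε))
      fun δ hδ => Real.rpow_le_rpow_of_exponent_le hn1 (by linarith [hτn δ hδ, hM δ hδ])
    have htv := tvDist_le_truncated G hprob (by lia : 1 ≤ n) hβ0 (√(2 * 1 * Real.log n))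
    rw [← rpow_tau G hprob hn 1] at htv
    refine htv.trans (Real.sqrt_le_sqrt ?_)
    have hlog : 0 ≤ Real.log n := Real.log_nonneg hn1
    set H := ∫ x in {x | |x| ≤ √(2 * 1 * Real.log n)}, likelihoodRatio (G n) x ^ 2
      ∂gaussianReal 0 1
    have hH0 : 0 ≤ H := integral_nonneg fun x => sq_nonneg _
    set p : ℝ := (n : ℝ) ^ (-β) with hp
    have hp01 := rpow_neg_mem_Icc (by lia : 1 ≤ n) hβ0
    -- The bound M at δ = 1 says 1 + τ(1) ≤ 1/2 + M < β, so exceedances of the truncation level are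
    -- negligible.
    have hnp : n * (p * (n : ℝ) ^ tau G n 1) ≤ (n : ℝ) ^ (-ε) := by
      rw [hp, ← Real.rpow_add hn0, ← Real.rpow_one_add' hn0.le]
      · refine Real.rpow_le_rpow_of_exponent_le hn1 ?_
        have := hτn 1 (by simp)
        have := hM 1 (by simp)
        linarith
      · have := hτn 1 (by simp)
        have := hM 1 (by simp)
        exact ne_of_lt (by linarith)
    have hm : 1 - (n : ℝ) ^ (-ε) ≤ (1 - p * (n : ℝ) ^ tau G n 1) ^ n := by
      have hle : p * (n : ℝ) ^ tau G n 1 ≤ 1 :=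
        mul_le_one₀ hp01.2 (by positivity)
          (Real.rpow_le_one_of_one_le_of_nonpos hn1 (tau_nonpos G hprob hn 1))
      have := one_add_mul_le_pow (a := -(p * (n : ℝ) ^ tau G n 1)) (by linarith) n
      rw [← sub_eq_add_neg] at this
      linarith
    have hs : (1 + p ^ 2 * H) ^ n ≤
        Real.exp (C * ((2 + Real.log n) * (n : ℝ) ^ (-(2 * ε / 3))) ^ 3) := by
      calc (1 + p ^ 2 * H) ^ n ≤ Real.exp (p ^ 2 * H) ^ n := by
            gcongr
            rw [add_comm]; exact Real.add_one_le_exp _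
        _ = Real.exp (n * p ^ 2 * H) := by rw [← Real.exp_nat_mul]; congr 1; ring
        _ ≤ _ := by
          refine Real.exp_le_exp.2 ?_
          calc n * p ^ 2 * H ≤ n * p ^ 2 *
              (C * ((2 + Real.log n) ^ 3 * (n : ℝ) ^ (2 * M + 2 * ε))) := by
                gcongr
                refine hH.trans (mul_le_mul_of_nonneg_left (mul_le_mul_of_nonneg_right
                  (pow_le_pow_left₀ (by positivity) (one_add_sqrt_two_mul_le hlog) 3)
                  (by positivity)) hC)
            _ = C * ((2 + Real.log n) ^ 3 * (n * p ^ 2 * (n : ℝ) ^ (2 * M + 2 * ε))) := by ring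
            _ = _ := by
              rw [mul_pow]
              congr 2
              rw [hp, ← Real.rpow_natCast, ← Real.rpow_natCast, ← Real.rpow_mul hn0.le,
                ← Real.rpow_mul hn0.le]
              nth_rewrite 1 [← Real.rpow_one (n : ℝ)]
              rw [← Real.rpow_add hn0, ← Real.rpow_add hn0]
              congr 1
              push_cast
              rw [hεβ]; ring
    linarith

/-! ### Detection by the maximum at threshold √(2 log n) -/

lemma exp_neg_sqrt_two_mul_sq {y : ℝ} (hy : 0 ≤ y) (a : ℝ) :
    -(a * √(2 * 1 * y)) ^ 2 / 2 = -(a ^ 2 * y) := by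
  rw [mul_pow, Real.sq_sqrt (by positivity)]; ring

lemma tendsto_sqrt_two_mul_log :
    Tendsto (fun n : ℕ => √(2 * 1 * Real.log n)) atTop atTop :=
  Real.tendsto_sqrt_atTop.comp (tendsto_log_natCast.const_mul_atTop (by norm_num))

lemma tendsto_mul_gaussianReal_real_lt_abs :
    Tendsto (fun n : ℕ => n * (gaussianReal 0 1).real {x | √(2 * 1 * Real.log n) < |x|})
      atTop (𝓝 0) := by
  have hlim : Tendsto (fun n : ℕ => 2 / √(2 * 1 * Real.log n)) atTop (𝓝 0) :=
    tendsto_const_nhds.div_atTop tendsto_sqrt_two_mul_log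
  refine squeeze_zero' (Eventually.of_forall fun n => by positivity) ?_ hlim
  filter_upwards [eventually_ge_atTop 2] with n hn
  have hn' : (2 : ℝ) ≤ n := by exact_mod_cast hn
  have hlog : 0 < Real.log n := Real.log_pos (by linarith)
  set r := √(2 * 1 * Real.log n) with hr
  have hr0 : 0 < r := by positivity
  have h1 := (gaussianReal_real_lt_abs_le r).trans
    (mul_le_mul_of_nonneg_left (gaussianReal_real_Ioi_le_mills hr0) two_pos.le)
  have h2 : Real.exp (-r ^ 2 / 2) = (n : ℝ)⁻¹ := by
    have := exp_neg_sqrt_two_mul_sq hlog.le 1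
    rw [one_mul, ← hr] at this
    rw [this, one_pow, one_mul, Real.exp_neg, Real.exp_log (by linarith)]
  rw [h2] at h1
  calc _ ≤ n * (2 * ((n : ℝ)⁻¹ / r)) := by gcongr
    _ = 2 / r := by field_simp

section MaxTest

variable (G : ℕ → Measure ℝ) {τ β : ℝ}

lemma tendsto_altLaw_maxStat_le (hprob : ∀ n, IsProbabilityMeasure (G n))
    (hτ : Tendsto (fun n => tau G n 1) atTop (𝓝 τ)) (hβ0 : 0 ≤ β) (hβ : β < 1 + τ) :
    Tendsto (fun n => (altLaw G β n).real {x | maxStat x ≤ √(2 * 1 * Real.log n)})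
      atTop (𝓝 0) := by
  set c := (1 + τ - β) / 2 with hc
  have hc0 : 0 < c := by rw [hc]; linarith
  have hlim : Tendsto (fun n : ℕ => Real.exp (-(n : ℝ) ^ c)) atTop (𝓝 0) :=
    Real.tendsto_exp_neg_atTop_nhds_zero.comp
      ((tendsto_rpow_atTop hc0).comp tendsto_natCast_atTop_atTop)
  refine squeeze_zero' (Eventually.of_forall fun n => measureReal_nonneg) ?_ hlim
  filter_upwards [eventually_ge_atTop 2, hτ.eventually (lt_mem_nhds (by linarith : τ - c < τ))]
    with n hn hτn
  have hn' : (2 : ℝ) ≤ n := by exact_mod_cast hn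
  have hn0 : (0 : ℝ) < n := by linarith
  refine (altLaw_real_maxStat_le_exp G hprob (by lia : 1 ≤ n) hβ0 _).trans ?_
  rw [← rpow_tau G hprob hn 1]
  refine Real.exp_le_exp.2 (neg_le_neg ?_)
  nth_rewrite 2 [← Real.rpow_one (n : ℝ)]
  rw [← Real.rpow_add hn0, ← Real.rpow_add hn0]
  exact Real.rpow_le_rpow_of_exponent_le (by linarith) (by linarith)

lemma tendsto_nullLaw_maxStat_le :
    Tendsto (fun n => (nullLaw n).real {x | maxStat x ≤ √(2 * 1 * Real.log n)})
      atTop (𝓝 1) := by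
  have h := tendsto_mul_gaussianReal_real_lt_abs.const_sub 1
  rw [sub_zero] at h
  refine tendsto_of_tendsto_of_tendsto_of_le_of_le' h tendsto_const_nhds ?_
    (Eventually.of_forall fun n => measureReal_le_one)
  filter_upwards [eventually_ge_atTop 1] with n hn
  exact one_sub_le_nullLaw_real_maxStat_le hn _

lemma tendsto_maxTestPower (hprob : ∀ n, IsProbabilityMeasure (G n))
    (hτ : Tendsto (fun n => tau G n 1) atTop (𝓝 τ)) (hβ0 : 0 ≤ β) (hβ : β < 1 + τ)
    {α : ℝ} (hα0 : 0 < α) (hα1 : α < 1) :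
    Tendsto (maxTestPower G β α) atTop (𝓝 1) := by
  have h := (tendsto_altLaw_maxStat_le G hprob hτ hβ0 hβ).const_sub 1
  rw [sub_zero] at h
  refine tendsto_of_tendsto_of_tendsto_of_le_of_le' h tendsto_const_nhds ?_ ?_
  · filter_upwards [eventually_ge_atTop 1,
      tendsto_mul_gaussianReal_real_lt_abs.eventually (gt_mem_nhds hα0)] with n hn hnα
    have := isProbabilityMeasure_altLaw G hprob hn hβ0
    rw [← probReal_compl_eq_one_sub (measurableSet_maxStat_le hn _), ← compl_setOf_lt_maxStat]
    exact measureReal_mono fun x hx => lt_of_le_of_lt (maxCritVal_le hn hα1 hnα.le) hx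
  · filter_upwards [eventually_ge_atTop 1] with n hn
    have := isProbabilityMeasure_altLaw G hprob hn hβ0
    exact measureReal_le_one

lemma tendsto_tvDist_one (hprob : ∀ n, IsProbabilityMeasure (G n))
    (hτ : Tendsto (fun n => tau G n 1) atTop (𝓝 τ)) (hβ0 : 0 ≤ β) (hβ : β < 1 + τ) :
    Tendsto (fun n => tvDist (nullLaw n) (altLaw G β n)) atTop (𝓝 1) := by
  have h := tendsto_nullLaw_maxStat_le.sub (tendsto_altLaw_maxStat_le G hprob hτ hβ0 hβ)
  rw [sub_zero] at h
  refine tendsto_of_tendsto_of_tendsto_of_le_of_le' h tendsto_const_nhds ?_ ?_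
  · filter_upwards [eventually_ge_atTop 1] with n hn
    have := isProbabilityMeasure_altLaw G hprob hn hβ0
    exact (le_abs_self _).trans
      (abs_real_sub_le_tvDist _ _ (measurableSet_maxStat_le hn _))
  · filter_upwards [eventually_ge_atTop 1] with n hn
    have := isProbabilityMeasure_altLaw G hprob hn hβ0
    exact tvDist_le_one _ _

end MaxTest

/-! ### Matching the two bounds -/

/-- If `τ(δ) + δ/2` is dominated by its value at `δ = 1` as soon as it exceeds `c`, and the upper
critical level exceeds `1/2 + c`, then the critical level exists and equals `1 + τ(1)`. -/
lemma criticalSparsity_eq_one_add_tau (G : ℕ → Measure ℝ)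
    (hprob : ∀ n, IsProbabilityMeasure (G n)) {τ : ℝ → ℝ}
    (hτ : TendstoUniformlyOn (tau G) τ atTop (Set.Icc (0 : ℝ) 1)) {c : ℝ} (hc : 0 ≤ c)
    (hdom : ∀ δ ∈ Set.Icc (0 : ℝ) 1, c < τ δ + δ / 2 → τ δ + δ / 2 ≤ τ 1 + 1 / 2)
    (hupper : 1 / 2 + c < upperCriticalSparsity G) :
    lowerCriticalSparsity G = 1 + τ 1 ∧ upperCriticalSparsity G = 1 + τ 1 := by
  have hτ1 : Tendsto (fun n => tau G n 1) atTop (𝓝 (τ 1)) := hτ.tendsto_at (by simp)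
  have hτ1_le : τ 1 ≤ 0 := le_of_tendsto hτ1 <| by
    filter_upwards [eventually_ge_atTop 2] with n hn using tau_nonpos G hprob hn 1
  have hbdd : BddBelow (insert (1 : ℝ) {β : ℝ | 0 ≤ β ∧ β ≤ 1 ∧
      Tendsto (fun n => tvDist (nullLaw n) (altLaw G β n)) atTop (𝓝 0)}) := by
    refine ⟨0, ?_⟩
    rintro β (rfl | hβ)
    · exact zero_le_one
    · exact hβ.1
  have hupper_le : ∀ M, 0 ≤ M → (∀ δ ∈ Set.Icc (0 : ℝ) 1, τ δ + δ / 2 ≤ M) →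
      upperCriticalSparsity G ≤ 1 / 2 + M := by
    intro M hM0 hM
    refine le_of_forall_gt_imp_ge_of_dense fun β hβ => ?_
    rcases le_total β 1 with hβ1 | hβ1
    · exact csInf_le hbdd (Or.inr ⟨by linarith, hβ1,
        tendsto_tvDist_zero G hprob hτ hM (by linarith) hβ⟩)
    · exact (csInf_le hbdd (Or.inl rfl)).trans hβ1
  -- Otherwise τ(δ) + δ/2 ≤ c throughout [0, 1], since any larger value would be dominated by τ(1) +
  -- 1/2 ≤ c; then undetectability starts at 1/2 + c, against `hupper`.
  have hmax : c < τ 1 + 1 / 2 := by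
    by_contra! h
    refine absurd (hupper_le c hc fun δ hδ => ?_) (not_le.2 hupper)
    by_contra! h'
    linarith [hdom δ hδ h']
  have hM : ∀ δ ∈ Set.Icc (0 : ℝ) 1, τ δ + δ / 2 ≤ τ 1 + 1 / 2 := fun δ hδ => by
    by_contra! h'
    linarith [hdom δ hδ (hmax.trans h')]
  have hlower_le : 1 + τ 1 ∈ upperBounds (insert (0 : ℝ) {β : ℝ | 0 ≤ β ∧
      Tendsto (fun n => tvDist (nullLaw n) (altLaw G β n)) atTop (𝓝 1)}) := by
    rintro β (rfl | ⟨hβ0, hβ⟩)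
    · linarith
    · by_contra! h
      exact zero_ne_one (tendsto_nhds_unique
        (tendsto_tvDist_zero G hprob hτ hM hβ0 (by linarith)) hβ)
  constructor
  · apply le_antisymm (csSup_le (Set.insert_nonempty _ _) hlower_le)
    refine le_of_forall_lt_imp_le_of_dense fun β hβ => ?_
    rcases le_total β 0 with hβ0 | hβ0
    · exact hβ0.trans (le_csSup ⟨_, hlower_le⟩ (Or.inl rfl))
    · exact le_csSup ⟨_, hlower_le⟩ (Or.inr ⟨hβ0, tendsto_tvDist_one G hprob hτ1 hβ0 hβ⟩)
  · apply le_antisymm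
    · have := hupper_le (τ 1 + 1 / 2) (by linarith) hM
      linarith
    · refine le_csInf ⟨1, Or.inl rfl⟩ ?_
      rintro β (rfl | ⟨hβ0, _, hβ⟩)
      · linarith
      · by_contra! h
        exact zero_ne_one (tendsto_nhds_unique hβ
          (tendsto_tvDist_one G hprob hτ1 hβ0 h))

/-! ### Laplace principle for the tail exponent -/

/-- Discretization of `P(|μ + Z| > t)` over shells of `|μ|`. -/
lemma gaussianMixture_real_le_sum (ν : Measure ℝ) [IsProbabilityMeasure ν] {t : ℝ} {K : ℕ}
    {θ : ℕ → ℝ} (hθ0 : θ 0 = 0) (hθK : t ≤ θ (K + 1)) :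
    (gaussianMixture ν).real {x | t < |x|} ≤
      ∑ j ∈ Finset.range (K + 1),
        2 * Real.exp (-max (t - θ (j + 1)) 0 ^ 2 / 2) * (2 * tailMax ν (θ j)) := by
  -- `E 0` is the whole line, so that m = 0, which fails θ 0 < |m|, is also covered.
  set E : ℕ → Set ℝ := fun j => {m | j = 0 ∨ θ j < |m|} with hE
  have hEm : ∀ j, MeasurableSet (E j) := fun j => by
    rcases eq_or_ne j 0 with rfl | hj
    · simp [hE]
    · simpa [hE, hj] using measurableSet_lt_abs (θ j)
  have hEν : ∀ j, ν.real (E j) ≤ 2 * tailMax ν (θ j) := fun j => by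
    rcases eq_or_ne j 0 with rfl | hj
    · have := half_le_tailMax_zero ν
      rw [hθ0]
      exact measureReal_le_one.trans (by linarith)
    · simpa [hE, hj] using real_lt_abs_le_tailMax ν (θ j)
  set w : ℕ → ℝ := fun j => 2 * Real.exp (-max (t - θ (j + 1)) 0 ^ 2 / 2) with hw
  have hw0 : ∀ j, 0 ≤ w j := fun j => by positivity
  have hpt : ∀ m : ℝ, (gaussianReal 0 1).real ((fun z => m + z) ⁻¹' {x | t < |x|}) ≤
      ∑ j ∈ Finset.range (K + 1), (E j).indicator (fun _ => w j) m := by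
    intro m
    classical
    set j := Nat.findGreatest (fun j => m ∈ E j) K with hj
    have hjK : j ≤ K := Nat.findGreatest_le K
    have hjE : m ∈ E j := Nat.findGreatest_spec (P := fun j => m ∈ E j) (Nat.zero_le K)
      (Or.inl rfl)
    have hle : (gaussianReal 0 1).real ((fun z => m + z) ⁻¹' {x | t < |x|}) ≤ w j := by
      rcases le_or_gt (t - θ (j + 1)) 0 with hneg | hpos
      · simp only [hw, max_eq_right hneg]
        exact measureReal_le_one.trans (by norm_num)
      · have hjK' : j < K := lt_of_le_of_ne hjK fun h => by rw [h] at hpos; linarith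
        have hm : |m| ≤ θ (j + 1) := by
          have := Nat.findGreatest_is_greatest (P := fun j => m ∈ E j) (k := j + 1)
            (Nat.lt_succ_self j) hjK'
          simpa [hE] using this
        simp only [hw, max_eq_left hpos.le]
        refine (measureReal_mono fun z hz => ?_).trans ((gaussianReal_real_lt_abs_le
          (t - θ (j + 1))).trans (mul_le_mul_of_nonneg_left
            (gaussianReal_real_Ioi_le_exp hpos.le) two_pos.le))
        have h1 : t < |m + z| := hz
        have h2 := abs_add_le m z
        show t - θ (j + 1) < |z|
        linarith
    calc _ ≤ w j := hle
      _ = (E j).indicator (fun _ => w j) m := (Set.indicator_of_mem hjE fun _ => w j).symm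
      _ ≤ _ := Finset.single_le_sum
          (f := fun j => (E j).indicator (fun _ => w j) m)
          (fun i _ => Set.indicator_nonneg (fun _ _ => hw0 i) m)
          (Finset.mem_range.2 (Nat.lt_succ_of_le hjK))
  have hind : ∀ j, Integrable ((E j).indicator fun _ => w j) ν := fun j =>
    (integrable_const (w j)).indicator (hEm j)
  rw [gaussianMixture_real ν (measurableSet_lt_abs t)]
  calc _ ≤ ∫ m, ∑ j ∈ Finset.range (K + 1), (E j).indicator (fun _ => w j) m ∂ν :=
        integral_mono (integrable_gaussianReal_real_preimage_add ν (measurableSet_lt_abs t))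
          (integrable_finsetSum _ fun j _ => hind j) hpt
    _ = ∑ j ∈ Finset.range (K + 1), w j * ν.real (E j) := by
        rw [integral_finsetSum _ fun j _ => hind j]
        refine Finset.sum_congr rfl fun j _ => ?_
        rw [integral_indicator (hEm j), setIntegral_const, smul_eq_mul, mul_comm]
    _ ≤ _ := Finset.sum_le_sum fun j _ => mul_le_mul_of_nonneg_left (hEν j) (hw0 j)

/-- Among the K + 1 shells, one carries at least the average share of the tail probability. On the
logarithmic scale the factor 4(K + 1) disappears. The shell may vary with n, but K does not. -/
lemma exists_tau_le (G : ℕ → Measure ℝ) (hprob : ∀ n, IsProbabilityMeasure (G n)) {d : ℝ}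
    (hd0 : 0 ≤ d) (hd1 : d ≤ 1) {ε : ℝ} (hε : 0 < ε) :
    ∃ K : ℕ, 1 ≤ K ∧ ∀ᶠ n : ℕ in atTop, ∃ j ≤ K,
      0 < tailMax (G n) (j / K * (d * √(2 * 1 * Real.log n))) ∧
      tau G n (d ^ 2) ≤
        Real.log (tailMax (G n) (j / K * (d * √(2 * 1 * Real.log n)))) / Real.log n -
          d ^ 2 * (1 - j / K) ^ 2 + ε := by
  -- Rounding u to the grid changes the squared distance by at most 2/K ≤ ε/2; the other ε/2 pays
  -- for the factor 4(K + 1).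
  obtain ⟨K, hK⟩ := exists_nat_gt (max 1 (4 / ε))
  have hK1 : (1 : ℝ) < K := (le_max_left _ _).trans_lt hK
  have hKε : 2 / K ≤ ε / 2 := by
    have h := (le_max_right _ _).trans_lt hK
    rw [div_lt_iff₀ hε] at h
    rw [div_le_iff₀ (by linarith)]
    linarith
  refine ⟨K, by exact_mod_cast hK1.le, ?_⟩
  filter_upwards [eventually_ge_atTop 2, tendsto_log_natCast.eventually_ge_atTop
    (2 / ε * Real.log (4 * (K + 1)))] with n hn hbig
  have hn' : (2 : ℝ) ≤ n := by exact_mod_cast hn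
  have hlog : 0 < Real.log n := Real.log_pos (by linarith)
  set r := √(2 * 1 * Real.log n) with hr
  have hr0 : 0 ≤ r := Real.sqrt_nonneg _
  have hdr : √(2 * d ^ 2 * Real.log n) = d * r := by
    rw [hr, show 2 * d ^ 2 * Real.log n = d ^ 2 * (2 * 1 * Real.log n) by ring,
      Real.sqrt_mul (sq_nonneg d), Real.sqrt_sq hd0]
  have hS := gaussianMixture_real_lt_abs_pos (G n) (d * r)
  have hsum := gaussianMixture_real_le_sum (G n) (t := d * r) (K := K)
    (θ := fun j => j / K * (d * r)) (by simp) (by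
      push_cast
      refine le_mul_of_one_le_left (by positivity) ?_
      rw [one_le_div (by linarith)]; linarith)
  obtain ⟨j, hj, hle⟩ := Finset.exists_le_of_sum_le (s := Finset.range (K + 1))
    (f := fun _ => (gaussianMixture (G n)).real {x | d * r < |x|} / (K + 1))
    (by simp) (le_trans (le_of_eq (by simp; field_simp)) hsum)
  refine ⟨j, Nat.lt_succ_iff.1 (Finset.mem_range.1 hj), ?_⟩
  have hjK : (j : ℝ) ≤ K := by exact_mod_cast Nat.lt_succ_iff.1 (Finset.mem_range.1 hj)
  set T := tailMax (G n) (j / K * (d * r)) with hT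
  set e := max (d * r - ((j + 1 : ℕ) : ℝ) / K * (d * r)) 0 with he
  have hle' : (gaussianMixture (G n)).real {x | d * r < |x|} ≤
      4 * (K + 1) * Real.exp (-e ^ 2 / 2) * T := by
    rw [div_le_iff₀ (by positivity)] at hle
    exact hle.trans (le_of_eq (by ring))
  have hT0 : 0 < T := by
    by_contra! h
    have : 4 * (K + 1) * Real.exp (-e ^ 2 / 2) * T ≤ 0 :=
      mul_nonpos_of_nonneg_of_nonpos (by positivity) h
    linarith
  refine ⟨hT0, ?_⟩
  have hlogS := Real.log_le_log hS hle'
  rw [Real.log_mul (by positivity) hT0.ne', Real.log_mul (by positivity) (Real.exp_pos _).ne',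
    Real.log_exp, ← hdr, ← tau_mul_log G hn] at hlogS
  set u : ℝ := j / K with hu
  have hu0 : 0 ≤ u := by positivity
  have hu1 : u ≤ 1 := by rw [hu, div_le_one (by linarith)]; exact hjK
  have hK0 : 0 < 1 / (K : ℝ) := by positivity
  have hK2 : 2 / (K : ℝ) = 2 * (1 / K) := by ring
  have he' : e = r * max (d * (1 - u) - d * (1 / K)) 0 := by
    rw [he, mul_max_of_nonneg _ _ hr0, mul_zero, hu]
    congr 1
    push_cast
    ring
  have hr2 : r ^ 2 = 2 * Real.log n := by rw [hr, Real.sq_sqrt (by positivity)]; ring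
  have he2 : d ^ 2 * (1 - u) ^ 2 - 2 / K ≤ max (d * (1 - u) - d * (1 / K)) 0 ^ 2 := by
    have hdd : d * d * (1 - u) ≤ 1 :=
      mul_le_one₀ (mul_le_one₀ hd1 hd0 hd1) (by linarith) (by linarith)
    rw [hK2]
    rcases le_total (d * (1 - u) - d * (1 / K)) 0 with h | h
    · rw [max_eq_right h]
      have h' : 0 ≤ d * (1 - u) := mul_nonneg hd0 (by linarith)
      nlinarith
    · rw [max_eq_left h]
      nlinarith [sq_nonneg (d * (1 / (K : ℝ)))]
  have hexp : -e ^ 2 / 2 ≤ -(d ^ 2 * (1 - u) ^ 2 - ε / 2) * Real.log n := by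
    rw [he', mul_pow, hr2]
    have : d ^ 2 * (1 - u) ^ 2 - ε / 2 ≤ max (d * (1 - u) - d * (1 / K)) 0 ^ 2 := by linarith
    have := mul_le_mul_of_nonneg_right this hlog.le
    linarith
  have hbig' : Real.log (4 * (K + 1)) ≤ ε / 2 * Real.log n := by
    have := mul_le_mul_of_nonneg_left hbig (by positivity : 0 ≤ ε / 2)
    rwa [← mul_assoc, show ε / 2 * (2 / ε) = 1 by field_simp, one_mul] at this
  have hfin : tau G n (d ^ 2) * Real.log n ≤
      Real.log T - d ^ 2 * (1 - u) ^ 2 * Real.log n + ε * Real.log n := by linarith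
  calc tau G n (d ^ 2) ≤
        (Real.log T - d ^ 2 * (1 - u) ^ 2 * Real.log n + ε * Real.log n) / Real.log n := by
        rwa [le_div_iff₀ hlog]
    _ = _ := by field_simp

/-- A mean beyond v·r leaves the noise a distance (1 - v)r to cover. The prefactor of the Gaussian
lower bound depends only on r, so one n^(-ε) absorbs it for all v; this uniformity lets v follow the
n-dependent shell of `exists_tau_le`. -/
lemma eventually_le_tau_one (G : ℕ → Measure ℝ) (hprob : ∀ n, IsProbabilityMeasure (G n))
    {ε : ℝ} (hε : 0 < ε) :
    ∀ᶠ n : ℕ in atTop, ∀ v ∈ Set.Icc (0 : ℝ) 1,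
      0 < tailMax (G n) (v * √(2 * 1 * Real.log n)) →
      Real.log (tailMax (G n) (v * √(2 * 1 * Real.log n))) / Real.log n - (1 - v) ^ 2 - ε ≤
        tau G n 1 := by
  set c := Real.exp (-3 / 2) * (√(2 * Real.pi))⁻¹ with hc
  have hc0 : 0 < c := by positivity
  have hlim := (tendsto_log_mul_rpow_neg hε).eventually (gt_mem_nhds hc0)
  filter_upwards [eventually_ge_atTop 2, hlim] with n hn hnc v hv hT0
  have hn' : (2 : ℝ) ≤ n := by exact_mod_cast hn
  have hn0 : (0 : ℝ) < n := by linarith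
  have hlog : 0 < Real.log n := Real.log_pos (by linarith)
  set r := √(2 * 1 * Real.log n) with hr
  have hr0 : 0 ≤ r := Real.sqrt_nonneg _
  set T := tailMax (G n) (v * r)
  have h1 := tailMax_mul_le (G n) (v * r) r
  have h2 := exp_mul_le_gaussianReal_real_Ioi hr0
    (by nlinarith [hv.1] : r - v * r ≤ r)
  have hexp : -(r - v * r) ^ 2 / 2 = -((1 - v) ^ 2 * Real.log n) := by
    rw [← exp_neg_sqrt_two_mul_sq hlog.le]; ring
  rw [hexp] at h2
  have hcr : (n : ℝ) ^ (-ε) ≤ c * (1 + r)⁻¹ := by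
    rw [← div_eq_mul_inv, le_div_iff₀ (by positivity), mul_comm]
    exact (mul_le_mul_of_nonneg_right (one_add_sqrt_two_mul_le hlog.le)
      (by positivity)).trans hnc.le
  have h3 : T * ((n : ℝ) ^ (-ε) * Real.exp (-((1 - v) ^ 2 * Real.log n))) ≤
      (gaussianMixture (G n)).real {x | r < |x|} := by
    refine le_trans (mul_le_mul_of_nonneg_left ?_ hT0.le) h1
    refine le_trans ?_ h2
    rw [← mul_assoc]
    gcongr
  have hlogS := Real.log_le_log (by positivity) h3
  rw [← tau_mul_log G hn, Real.log_mul hT0.ne' (by positivity),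
    Real.log_mul (by positivity) (by positivity), Real.log_exp, Real.log_rpow hn0] at hlogS
  calc _ = (Real.log T + (-ε * Real.log n + -((1 - v) ^ 2 * Real.log n))) / Real.log n := by
        field_simp; ring
    _ ≤ tau G n 1 := by rwa [div_le_iff₀ hlog]

/-! ### Domination above 1/4, for arbitrary means -/

/-- Let v·r be the location of the dominant means at level d². Raising the level to 1 with the same
means costs (1 - v)² - (d - v)² = (1 - d)(1 + d - 2v), which is at most (1 - d²)/2 once v ≥ 1/2. A
value above 1/4 forces v > 1/2. -/
lemma tau_add_half_le_of_quarter_lt (G : ℕ → Measure ℝ)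
    (hprob : ∀ n, IsProbabilityMeasure (G n)) {δ a b : ℝ} (hδ : δ ∈ Set.Icc (0 : ℝ) 1)
    (ha : Tendsto (fun n => tau G n δ) atTop (𝓝 a)) (hb : Tendsto (fun n => tau G n 1) atTop (𝓝 b))
    (hquarter : 1 / 4 < a + δ / 2) : a + δ / 2 ≤ b + 1 / 2 := by
  obtain ⟨d, hd0, hd1, rfl⟩ : ∃ d : ℝ, 0 ≤ d ∧ d ≤ 1 ∧ d ^ 2 = δ :=
    ⟨√δ, Real.sqrt_nonneg _, Real.sqrt_le_one.2 hδ.2, Real.sq_sqrt hδ.1⟩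
  refine le_of_forall_pos_le_add fun η hη => ?_
  set ε := min (η / 2) ((a + d ^ 2 / 2 - 1 / 4) / 2)
  have hε : 0 < ε := lt_min (by linarith) (by linarith)
  have hε1 : 2 * ε ≤ η := by linarith [min_le_left (η / 2) ((a + d ^ 2 / 2 - 1 / 4) / 2)]
  have hε2 : 2 * ε ≤ a + d ^ 2 / 2 - 1 / 4 := by
    linarith [min_le_right (η / 2) ((a + d ^ 2 / 2 - 1 / 4) / 2)]
  obtain ⟨K, hK, hev⟩ := exists_tau_le G hprob hd0 hd1 hε
  have hKpos : (0 : ℝ) < K := by exact_mod_cast hK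
  suffices h : ∀ᶠ n in atTop, tau G n (d ^ 2) + d ^ 2 / 2 - 1 / 2 - 2 * ε ≤ tau G n 1 by
    have := le_of_tendsto_of_tendsto
      (((ha.add_const (d ^ 2 / 2)).sub_const (1 / 2)).sub_const (2 * ε)) hb h
    linarith
  filter_upwards [hev, eventually_le_tau_one G hprob hε, eventually_ge_atTop 2,
    ha.eventually (lt_mem_nhds (by linarith : a - ε < a))] with n hn1 hn2 hn hna
  obtain ⟨j, hj, hT0, hup⟩ := hn1
  have hn' : (2 : ℝ) ≤ n := by exact_mod_cast hn
  have hlog : 0 < Real.log n := Real.log_pos (by linarith)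
  have hu1 : (j : ℝ) / K ≤ 1 := by rw [div_le_one hKpos]; exact_mod_cast hj
  have hu0 : 0 ≤ (j : ℝ) / K := by positivity
  set u : ℝ := j / K
  rw [← mul_assoc] at hup hT0
  have hlow := hn2 (u * d) ⟨by positivity, mul_le_one₀ hu1 hd0 hd1⟩ hT0
  have hTneg : Real.log (tailMax (G n) (u * d * √(2 * 1 * Real.log n))) / Real.log n ≤ 0 :=
    div_nonpos_of_nonpos_of_nonneg (Real.log_nonpos hT0.le (tailMax_le_one _ _)) hlog.le
  set q := Real.log (tailMax (G n) (u * d * √(2 * 1 * Real.log n))) / Real.log n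
  have hs0 : 0 ≤ u * d := by positivity
  -- With v = u·d, d²/2 - (d - v)² = v² - (d - 2v)²/2, which is at most 1/4 if v ≤ 1/2; `hε2` keeps
  -- the errors below the excess over 1/4.
  have hs : 1 / 2 < u * d := by
    by_contra! h
    nlinarith [sq_nonneg (d - 2 * (u * d))]
  have hgain : d ^ 2 / 2 - 1 / 2 ≤ d ^ 2 * (1 - u) ^ 2 - (1 - u * d) ^ 2 := by
    nlinarith [mul_nonneg (by linarith : 0 ≤ 1 - d) (by linarith : 0 ≤ 2 * (u * d) - 1),
      mul_nonneg (by linarith : 0 ≤ 1 - d) (by linarith : 0 ≤ 1 - d)]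
  linarith

/-! ### Domination for scale families with regularly varying tail exponent -/

lemma tailMax_scale {ν ν₀ : Measure ℝ} {σ : ℝ} (h : ∀ θ, cdf ν θ = cdf ν₀ (θ / σ)) (θ : ℝ) :
    tailMax ν θ = tailMax ν₀ (θ / σ) := by
  rw [tailMax, tailMax, h, h, neg_div]

lemma log_tailMax (ν : Measure ℝ) (θ : ℝ) : Real.log (tailMax ν θ) = -tailExponent ν θ := by
  rw [tailExponent, neg_neg, tailMax]

lemma tailMax_pos {ν : Measure ℝ} (h : ∀ᶠ θ in atTop, 0 < tailExponent ν θ) (θ : ℝ) :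
    0 < tailMax ν θ := by
  obtain ⟨x, hx, hθx⟩ := (h.and (eventually_ge_atTop θ)).exists
  refine lt_of_lt_of_le ((tailMax_nonneg ν x).lt_of_ne fun h0 => ?_) (antitone_tailMax ν hθx)
  -- A vanishing tail would give exponent 0, because `Real.log 0 = 0`, and not a positive one.
  have := log_tailMax ν x
  rw [← h0, Real.log_zero] at this
  linarith

section ScaleFamily

variable {G : ℕ → Measure ℝ} {ν : Measure ℝ} {σ : ℕ → ℝ}

/-- If the scale keeps up with √(2 log n) along a subsequence, the mean alone clears the threshold
there with probability bounded away from 0. As τ_n(1) converges, the subsequence determines the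
limit. -/
lemma tau_one_nonneg_of_frequently_lt (hprob : ∀ n, IsProbabilityMeasure (G n))
    (hscale : ∀ n θ, cdf (G n) θ = cdf ν (θ / σ n))
    (hpos : ∀ᶠ θ in atTop, 0 < tailExponent ν θ) {b : ℝ}
    (hb : Tendsto (fun n => tau G n 1) atTop (𝓝 b)) {C : ℝ}
    (hC : ∃ᶠ n : ℕ in atTop, √(2 * 1 * Real.log n) / σ n < C) : 0 ≤ b := by
  refine le_of_forall_pos_le_add fun η hη => ?_
  have hlim : Tendsto (fun n : ℕ => Real.log (tailMax ν C) / Real.log n) atTop (𝓝 0) :=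
    tendsto_const_nhds.div_atTop tendsto_log_natCast
  by_contra! hbη
  obtain ⟨n, hnC, hn, h1, h2, h3⟩ := (hC.and_eventually ((eventually_ge_atTop 2).and
    ((eventually_le_tau_one G hprob (half_pos hη)).and ((hlim.eventually
      (lt_mem_nhds (by linarith : -(η / 2) < 0))).and
      (hb.eventually (gt_mem_nhds (by linarith : b < -η))))))).exists
  have hn' : (2 : ℝ) ≤ n := by exact_mod_cast hn
  have hlog : 0 < Real.log n := Real.log_pos (by linarith)
  have hle : tailMax ν C ≤ tailMax (G n) (1 * √(2 * 1 * Real.log n)) := by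
    rw [one_mul, tailMax_scale (hscale n)]
    exact antitone_tailMax ν hnC.le
  have hC0 := tailMax_pos hpos C
  have h4 := h1 1 (by simp) (hC0.trans_le hle)
  have h5 : Real.log (tailMax ν C) / Real.log n ≤
      Real.log (tailMax (G n) (1 * √(2 * 1 * Real.log n))) / Real.log n := by gcongr
  linarith

/-- The ratio of exponents tends to d^(-γ) ≤ d^(-2). This is where γ ≤ 2 enters: stretching a mean
by 1/d costs no more than stretching Gaussian noise. -/
lemma eventually_tailExponent_le {γ : ℝ} (hreg : RegularlyVarying (tailExponent ν) γ)
    (hγ : γ ≤ 2) {d : ℝ} (hd0 : 0 < d) (hd1 : d ≤ 1) {ε : ℝ} (hε : 0 < ε) :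
    ∀ᶠ x in atTop, d ^ 2 * tailExponent ν (d⁻¹ * x) ≤ (1 + ε) * tailExponent ν x := by
  have hle : d⁻¹ ^ γ < (1 + ε) / d ^ 2 := by
    calc d⁻¹ ^ γ ≤ d⁻¹ ^ (2 : ℝ) :=
          Real.rpow_le_rpow_of_exponent_le ((one_le_inv₀ hd0).2 hd1) hγ
      _ = 1 / d ^ 2 := by rw [Real.rpow_two]; field_simp
      _ < _ := by gcongr; linarith
  filter_upwards [hreg.1, (hreg.2 d⁻¹ (by positivity)).eventually (gt_mem_nhds hle)] with x hx hlt
  rw [div_lt_div_iff₀ hx (by positivity)] at hlt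
  linarith

/-- Stretching the dominant configuration at level d² by 1/d reaches level 1; both the noise cost
and, asymptotically, the tail cost grow by at most d^(-2). -/
lemma div_le_tau_one_of_tendsto (hprob : ∀ n, IsProbabilityMeasure (G n))
    (hscale : ∀ n θ, cdf (G n) θ = cdf ν (θ / σ n))
    {γ : ℝ} (hreg : RegularlyVarying (tailExponent ν) γ) (hγ : γ ≤ 2)
    (hσ : Tendsto (fun n : ℕ => √(2 * 1 * Real.log n) / σ n) atTop atTop)
    {d a b : ℝ} (hd0 : 0 < d) (hd1 : d ≤ 1)
    (ha : Tendsto (fun n => tau G n (d ^ 2)) atTop (𝓝 a))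
    (hb : Tendsto (fun n => tau G n 1) atTop (𝓝 b)) : a ≤ d ^ 2 * b := by
  -- The term ε(ε - a) comes from the relative error 1 + ε in the tail exponent, whose size relative
  -- to log n is at most ε - τ_n(d²).
  suffices h : ∀ ε : ℝ, 0 < ε → a - 3 * ε - ε * (ε - a) ≤ d ^ 2 * b by
    have hlim : Tendsto (fun ε : ℝ => a - 3 * ε - ε * (ε - a)) (𝓝[>] 0) (𝓝 a) := by
      have : Continuous fun ε : ℝ => a - 3 * ε - ε * (ε - a) := by fun_prop
      simpa using (this.tendsto 0).mono_left nhdsWithin_le_nhds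
    exact le_of_tendsto hlim (eventually_mem_nhdsWithin.mono fun ε hε => h ε hε)
  intro ε hε
  obtain ⟨K, hK, hev⟩ := exists_tau_le G hprob hd0.le hd1 hε
  have hKpos : (0 : ℝ) < K := by exact_mod_cast hK
  -- Regular variation needs arguments tending to infinity, hence j ≥ 1.
  have hratio : ∀ᶠ n : ℕ in atTop, ∀ j ∈ Finset.Icc 1 K,
      d ^ 2 * tailExponent ν (j / K * √(2 * 1 * Real.log n) / σ n) ≤
        (1 + ε) * tailExponent ν (j / K * (d * √(2 * 1 * Real.log n)) / σ n) := by
    rw [Filter.eventually_all_finset]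
    intro j hj
    have hj0 : (0 : ℝ) < j := by exact_mod_cast (Finset.mem_Icc.1 hj).1
    have htend : Tendsto (fun n : ℕ => j / K * (d * √(2 * 1 * Real.log n)) / σ n) atTop atTop := by
      refine (hσ.const_mul_atTop (by positivity : 0 < (j : ℝ) / K * d)).congr fun n => ?_
      ring
    filter_upwards [htend.eventually (eventually_tailExponent_le hreg hγ hd0 hd1 hε)] with n hn
    convert hn using 3
    field_simp
  have hlim : Tendsto (fun n : ℕ => Real.log (1 / 2) / Real.log n) atTop (𝓝 0) :=
    tendsto_const_nhds.div_atTop tendsto_log_natCast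
  refine le_of_tendsto_of_tendsto
    ((ha.sub_const (3 * ε)).sub ((ha.const_sub ε).const_mul ε)) (hb.const_mul (d ^ 2)) ?_
  filter_upwards [hev, hratio, eventually_le_tau_one G hprob hε, eventually_ge_atTop 2,
    hlim.eventually (lt_mem_nhds (by linarith : -ε < 0))] with n hn1 hn2 hn3 hn hhalf
  obtain ⟨j, hj, hT0, hup⟩ := hn1
  have hn' : (2 : ℝ) ≤ n := by exact_mod_cast hn
  have hlog : 0 < Real.log n := Real.log_pos (by linarith)
  have hu1 : (j : ℝ) / K ≤ 1 := by rw [div_le_one hKpos]; exact_mod_cast hj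
  have hu0 : 0 ≤ (j : ℝ) / K := by positivity
  have hneg := tau_nonpos G hprob hn (d ^ 2)
  have hd2 : d ^ 2 ≤ 1 := pow_le_one₀ hd0.le hd1
  have hd2' : 0 < d ^ 2 := by positivity
  have hε2 : d ^ 2 * ε ≤ ε := mul_le_of_le_one_left hε.le hd2
  have hprod : 0 ≤ ε * (ε - tau G n (d ^ 2)) := mul_nonneg hε.le (by linarith)
  have hTneg : Real.log (tailMax (G n) (j / K * (d * √(2 * 1 * Real.log n)))) / Real.log n ≤ 0 :=
    div_nonpos_of_nonpos_of_nonneg (Real.log_nonpos hT0.le (tailMax_le_one _ _)) hlog.le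
  -- In the innermost shell noise does all the work: τ_n(d²) ≤ -d² + ε, while τ_n(1) ≥ -1 - 2ε
  -- always, from tail mass at least 1/2 at 0.
  rcases Nat.eq_zero_or_pos j with rfl | hj1
  · have hpos0 : (1 : ℝ) / 2 ≤ tailMax (G n) (0 * √(2 * 1 * Real.log n)) := by
      rw [zero_mul]; exact half_le_tailMax_zero (G n)
    have hlow := hn3 0 (by simp) (lt_of_lt_of_le (by norm_num) hpos0)
    have : Real.log (1 / 2) / Real.log n ≤
        Real.log (tailMax (G n) (0 * √(2 * 1 * Real.log n))) / Real.log n := by gcongr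
    have hlow' : -1 - 2 * ε ≤ tau G n 1 := by linarith
    have := mul_le_mul_of_nonneg_left hlow' hd2'.le
    simp only [Nat.cast_zero, zero_div, sub_zero, one_pow, mul_one] at hup hTneg
    linarith
  · have hr := hn2 j (Finset.mem_Icc.2 ⟨hj1, hj⟩)
    have hlow := hn3 (j / K) ⟨hu0, hu1⟩ (by
      rw [tailMax_scale (hscale n)]; exact tailMax_pos hreg.1 _)
    rw [tailMax_scale (hscale n), log_tailMax] at hlow hup hTneg
    set q := tailExponent ν (j / K * (d * √(2 * 1 * Real.log n)) / σ n)
    set q' := tailExponent ν (j / K * √(2 * 1 * Real.log n) / σ n)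
    set u : ℝ := j / K
    have hr' : d ^ 2 * (q' / Real.log n) ≤ (1 + ε) * (q / Real.log n) := by
      rw [← mul_div_assoc, ← mul_div_assoc]; gcongr
    rw [neg_div] at hlow hup hTneg
    have hsq : 0 ≤ d ^ 2 * (1 - u) ^ 2 := by positivity
    have hq : ε * (q / Real.log n) ≤ ε * (ε - tau G n (d ^ 2)) :=
      mul_le_mul_of_nonneg_left (by linarith) hε.le
    have := mul_le_mul_of_nonneg_left hlow hd2'.le
    linarith

lemma tau_add_half_le_of_scale (hprob : ∀ n, IsProbabilityMeasure (G n))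
    (hscale : ∀ n θ, cdf (G n) θ = cdf ν (θ / σ n))
    {γ : ℝ} (hreg : RegularlyVarying (tailExponent ν) γ) (hγ : γ ≤ 2)
    {δ a b : ℝ} (hδ : δ ∈ Set.Icc (0 : ℝ) 1)
    (ha : Tendsto (fun n => tau G n δ) atTop (𝓝 a))
    (hb : Tendsto (fun n => tau G n 1) atTop (𝓝 b))
    (hpos : 0 < a + δ / 2) : a + δ / 2 ≤ b + 1 / 2 := by
  have ha0 : a ≤ 0 := le_of_tendsto ha <| by
    filter_upwards [eventually_ge_atTop 2] with n hn using tau_nonpos G hprob hn δ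
  -- If the ratio diverges, a + δ/2 ≤ δ(b + 1/2), and positivity of the left side allows δ to be
  -- replaced by 1. Otherwise b ≥ 0, and a ≤ 0 with δ ≤ 1 suffices.
  by_cases hσ : Tendsto (fun n : ℕ => √(2 * 1 * Real.log n) / σ n) atTop atTop
  · have hδ0 : 0 < δ := by linarith
    obtain ⟨d, hd0, hd1, rfl⟩ : ∃ d : ℝ, 0 < d ∧ d ≤ 1 ∧ d ^ 2 = δ :=
      ⟨√δ, Real.sqrt_pos.2 hδ0, Real.sqrt_le_one.2 hδ.2, Real.sq_sqrt hδ.1⟩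
    have h := div_le_tau_one_of_tendsto hprob hscale hreg hγ hσ hd0 hd1 ha hb
    have h1 : 0 < b + 1 / 2 := by
      by_contra! hle
      have := mul_nonpos_of_nonneg_of_nonpos hδ.1 hle
      linarith
    have h2 := mul_le_mul_of_nonneg_right hδ.2 h1.le
    linarith
  · rw [tendsto_atTop] at hσ
    push Not at hσ
    obtain ⟨C, hC⟩ := hσ
    have := tau_one_nonneg_of_frequently_lt hprob hscale hreg.1 hb
      (hC.mono fun n hn => hn)
    linarith [hδ.2]

end ScaleFamily

end SparseMeans

end

theorem theorem1 (G : ℕ → Measure ℝ) (hprob : ∀ n, IsProbabilityMeasure (G n))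
    (hconv : ∃ τ : ℝ → ℝ,
      TendstoUniformlyOn (SparseMeans.tau G) τ atTop (Set.Icc (0 : ℝ) 1))
    (hA : 3 / 4 < SparseMeans.upperCriticalSparsity G ∨
      ∃ (G₀ : Measure ℝ) (σ : ℕ → ℝ) (γ : ℝ), IsProbabilityMeasure G₀ ∧ (∀ n, 0 < σ n) ∧
        (∀ n θ, cdf (G n) θ = cdf G₀ (θ / σ n)) ∧
        SparseMeans.RegularlyVarying (SparseMeans.tailExponent G₀) γ ∧ γ ≤ 2)
    (hhalf : 1 / 2 < SparseMeans.upperCriticalSparsity G) :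
    SparseMeans.IsCriticalSparsityLevel G (SparseMeans.upperCriticalSparsity G) ∧
      ∀ β : ℝ, 0 < β → β < SparseMeans.upperCriticalSparsity G →
        ∀ α : ℝ, 0 < α → α < 1 →
          Tendsto (SparseMeans.maxTestPower G β α) atTop (𝓝 1) := by
  obtain ⟨τ, hτ⟩ := hconv
  have hτδ : ∀ δ ∈ Set.Icc (0 : ℝ) 1,
      Tendsto (fun n => SparseMeans.tau G n δ) atTop (𝓝 (τ δ)) := fun δ hδ => hτ.tendsto_at hδ
  have hτ1 := hτδ 1 (by simp)
  obtain ⟨hl, hu⟩ : SparseMeans.lowerCriticalSparsity G = 1 + τ 1 ∧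
      SparseMeans.upperCriticalSparsity G = 1 + τ 1 := by
    rcases hA with h34 | ⟨G₀, σ, γ, _, _, hscale, hreg, hγ⟩
    · exact SparseMeans.criticalSparsity_eq_one_add_tau G hprob hτ (c := 1 / 4) (by norm_num)
        (fun δ hδ h =>
          SparseMeans.tau_add_half_le_of_quarter_lt G hprob hδ (hτδ δ hδ) hτ1 h)
        (by linarith)
    · exact SparseMeans.criticalSparsity_eq_one_add_tau G hprob hτ le_rfl
        (fun δ hδ h =>
          SparseMeans.tau_add_half_le_of_scale hprob hscale hreg hγ hδ (hτδ δ hδ) hτ1 h)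
        (by linarith)
  refine ⟨⟨hl.trans hu.symm, rfl⟩, fun β hβ0 hβ α hα0 hα1 => ?_⟩
  rw [hu] at hβ
  exact SparseMeans.tendsto_maxTestPower G hprob hτ1 hβ0.le hβ hα0 hα1
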